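/- Fix countably infinite sets of individual names $a_i$, concept names $A_i$ and role names $R_i$ ($i<\omega$). $\mathcal{ALC}$-concepts are given by $C ::= A_i \mid \top \mid \neg C \mid C_1\sqcap C_2 \mid \exists R_i.C$. A TBox is a finite set of inclusions $C\sqsubseteq D$ between $\mathcal{ALC}$-concepts, an ABox a finite set of assertions $A_k(a_i)$, $R_k(a_i,a_j)$, and a knowledge base (KB) is a pair $\mathcal K=(\mathcal T,\mathcal A)$ of a TBox and an ABox; $\mathsf{ind}(\mathcal K)$ is the set of individual names in $\mathcal A$. Interpretations are the usual first-order ones under the standard name assumption $a_i^{\mathcal I}=a_i$; $\mathcal K$ is consistent if it has a model. $\mathcal K$ is an $\mathcal{EL}$ KB if $\neg$ does not occur in its TBox, and a $\textsl{Horn-}\mathcal{ALC}$ KB if in its TBox no concept of the form $\neg C$ occurs negatively and no concept of the form $\exists R.\neg C$ occurs positively (in $C\sqsubseteq D$, the concept $C$ occurs negatively and $D$ positively, and $\neg$ switches the polarity). A conjunctive query (CQ) $q(\vec x)=\exists\vec y\,\varphi(\vec x,\vec y)$ is an existentially quantified conjunction of atoms $A_k(z_1)$, $R_k(z_1,z_2)$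 with variables in $\vec x,\vec y$; it is rooted (an rCQ) if every $y\in\vec y$ is connected to some $x\in\vec x$ by a path in the graph whose edges are the pairs $\{u,v\}$ with $R(u,v)$ in $q$ for some $R$. Write $\mathcal K\models q(\vec a)$ if $q(\vec a)$ holds in all models of $\mathcal K$. A signature $\Sigma$ is a set of concept and role names; it is full if it contains all of them. For $\mathcal Q\in\{\mathrm{CQ},\mathrm{rCQ}\}$ and consistent KBs $\mathcal K_1,\mathcal K_2$, we say that $\mathcal K_1$ $\Sigma$-$\mathcal Q$ entails $\mathcal K_2$ if, for every $q(\vec x)$ in $\mathcal Q$ that uses only names from $\Sigma$ and every tuple $\vec a$ in $\mathsf{ind}(\mathcal K_2)$, $\mathcal K_2\models q(\vec a)$ implies $\vec a\subseteq\mathsf{ind}(\mathcal K_1)$ and $\mathcal K_1\models q(\vec a)$. $\mathcal K_1$ and $\mathcal K_2$ are $\Sigma$-$\mathcal Q$ inseparable if they $\Sigma$-$\mathcal Q$ entail each other. **Theorem.** Let $\mathcal L$ be $\textsl{Horn-}\mathcal{ALC}$ or $\mathcal{EL}$, and let $\mathcal Q\in\{\mathrm{CQ},\mathrm{rCQ}\}$.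 (i) The problem of deciding, given a finite signature $\Sigma$, a consistent $\mathcal L$ KB $\mathcal K_1$ and a consistent $\mathcal{ALC}$ KB $\mathcal K_2$, whether $\mathcal K_1$ $\Sigma$-$\mathcal Q$ entails $\mathcal K_2$ is undecidable. (ii) The problem of deciding, given a finite signature $\Sigma$, a consistent $\mathcal L$ KB $\mathcal K_1$ and a consistent $\mathcal{ALC}$ KB $\mathcal K_2$, whether $\mathcal K_1$ and $\mathcal K_2$ are $\Sigma$-$\mathcal Q$ inseparable is undecidable. (iii) Both problems remain undecidable when $\Sigma$ is fixed to be the full signature, so that the input consists of $\mathcal K_1$ and $\mathcal K_2$ only. Here undecidable means that no algorithm halts with the correct answer on all inputs of the stated form (it may behave arbitrarily on other inputs). -/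

import Mathlib

/-! Description logic `ALC`. Individual names `a_i`, concept names `A_i` and role names `R_i`
(`i < ω`) are represented by their indices, natural numbers. -/

namespace DL

/-- `ALC`-concepts `A_i | ⊤ | ¬C | C ⊓ D | ∃R_i.C`. -/
inductive Concept : Type
  | atom (A : ℕ)
  | top
  | neg (C : Concept)
  | inter (C D : Concept)
  | ex (R : ℕ) (C : Concept)
  deriving DecidableEq

namespace Concept

/-- Gödel numbering of concepts. -/
def toNat : Concept → ℕ
  | top => 0
  | atom A => 4 * A + 1
  | neg C => 4 * C.toNat + 2
  | inter C D => 4 * Nat.pair C.toNat D.toNat + 3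
  | ex R C => 4 * Nat.pair R C.toNat + 4

/-- The concept with a given Gödel number. -/
def ofNat : ℕ → Concept
  | 0 => top
  | n + 1 =>
    have h0 : n / 4 < n + 1 := by omega
    have h1 : (n / 4).unpair.1 < n + 1 := lt_of_le_of_lt (Nat.unpair_left_le _) h0
    have h2 : (n / 4).unpair.2 < n + 1 := lt_of_le_of_lt (Nat.unpair_right_le _) h0
    match n % 4 with
    | 0 => atom (n / 4)
    | 1 => neg (ofNat (n / 4))
    | 2 => inter (ofNat (n / 4).unpair.1) (ofNat (n / 4).unpair.2)
    | _ => ex (n / 4).unpair.1 (ofNat (n / 4).unpair.2)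

theorem ofNat_toNat (C : Concept) : ofNat C.toNat = C := by
  induction C with
  | top => simp [toNat, ofNat]
  | atom A =>
    have h1 : 4 * A / 4 = A := by omega
    have h2 : 4 * A % 4 = 0 := by omega
    simp [toNat, ofNat]
  | neg C ih =>
    have h1 : (4 * C.toNat + 1) / 4 = C.toNat := by omega
    have h2 : (4 * C.toNat + 1) % 4 = 1 := by omega
    simp [toNat, ofNat, h1, h2, ih]
  | inter C D ihC ihD =>
    have h1 : (4 * Nat.pair C.toNat D.toNat + 2) / 4 = Nat.pair C.toNat D.toNat := by omega
    have h2 : (4 * Nat.pair C.toNat D.toNat + 2) % 4 = 2 := by omega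
    simp [toNat, ofNat, h1, h2, ihC, ihD]
  | ex R C ih =>
    have h1 : (4 * Nat.pair R C.toNat + 3) / 4 = Nat.pair R C.toNat := by omega
    have h2 : (4 * Nat.pair R C.toNat + 3) % 4 = 3 := by omega
    simp [toNat, ofNat, h1, h2, ih]

theorem toNat_ofNat (n : ℕ) : (ofNat n).toNat = n := by
  induction n using Nat.strong_induction_on with
  | _ n ih =>
    cases n with
    | zero => simp [toNat, ofNat]
    | succ n =>
      have h0 : n / 4 < n + 1 := by omega
      have e0 := ih _ h0
      have e1 := ih _ (lt_of_le_of_lt (Nat.unpair_left_le (n / 4)) h0)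
      have e2 := ih _ (lt_of_le_of_lt (Nat.unpair_right_le (n / 4)) h0)
      rw [ofNat]
      have h4 : n % 4 < 4 := Nat.mod_lt _ (by norm_num)
      have hn := Nat.div_add_mod n 4
      rcases hm : n % 4 with _ | _ | _ | m
      · simp only [toNat]; omega
      · simp only [toNat, e0]; omega
      · simp only [toNat, e1, e2, Nat.pair_unpair]; omega
      · simp only [toNat, e2, Nat.pair_unpair]; omega

/-- Concepts are coded bijectively by natural numbers. -/
def equivNat : Concept ≃ ℕ where
  toFun := toNat
  invFun := ofNat
  left_inv := ofNat_toNat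
  right_inv := toNat_ofNat

instance : Primcodable Concept := Primcodable.ofEquiv ℕ equivNat

/-- `¬` does not occur in the concept. -/
def NegFree : Concept → Prop
  | atom _ => True
  | top => True
  | neg _ => False
  | inter C D => C.NegFree ∧ D.NegFree
  | ex _ C => C.NegFree

/-- The occurrences of subconcepts in a concept that itself occurs with polarity `p`
(`true`: positively, `false`: negatively); each is listed with its polarity. -/
def occurrences (p : Bool) : Concept → List (Bool × Concept)
  | atom A => [(p, atom A)]
  | top => [(p, top)]
  | neg C => (p, neg C) :: C.occurrences (!p)
  | inter C D => (p, inter C D) :: (C.occurrences p ++ D.occurrences p)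
  | ex R C => (p, ex R C) :: C.occurrences p

end Concept

/-- A TBox: finitely many concept inclusions, the pair `(C, D)` standing for `C ⊑ D`. -/
abbrev TBox : Type := List (Concept × Concept)

/-- An `EL` TBox does not contain `¬` at all. -/
def TBox.IsEL (T : TBox) : Prop :=
  ∀ ci ∈ T, ci.1.NegFree ∧ ci.2.NegFree

/-- In a Horn-`ALC` TBox no `¬C` occurs negatively and no `∃R.¬C` occurs positively; in `C ⊑ D`
the concept `C` occurs negatively and `D` positively. -/
def TBox.IsHornALC (T : TBox) : Prop :=
  ∀ ci ∈ T, ∀ o ∈ ci.1.occurrences false ++ ci.2.occurrences true,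
    (∀ C : Concept, o ≠ (false, Concept.neg C)) ∧
    (∀ (R : ℕ) (C : Concept), o ≠ (true, Concept.ex R (Concept.neg C)))

/-- ABox assertions `A(a)` and `R(a, b)`. -/
inductive Assertion : Type
  | conc (A a : ℕ)
  | role (R a b : ℕ)
  deriving DecidableEq

namespace Assertion

/-- Assertions as tuples of numbers. -/
def equivSum : Assertion ≃ (ℕ × ℕ) ⊕ (ℕ × ℕ × ℕ) where
  toFun
    | conc A a => Sum.inl (A, a)
    | role R a b => Sum.inr (R, a, b)
  invFun
    | Sum.inl p => conc p.1 p.2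
    | Sum.inr p => role p.1 p.2.1 p.2.2
  left_inv α := by cases α <;> rfl
  right_inv α := by rcases α with ⟨_, _⟩ | ⟨_, _, _⟩ <;> rfl

instance : Primcodable Assertion := Primcodable.ofEquiv _ equivSum

/-- The individual names in an assertion. -/
def inds : Assertion → Set ℕ
  | conc _ a => {a}
  | role _ a b => {a, b}

end Assertion

/-- A knowledge base: a TBox and an ABox (finitely many assertions). -/
structure KB : Type where
  tbox : TBox
  abox : List Assertion

/-- A knowledge base as the pair of its TBox and its ABox. -/
def KB.equivProd : KB ≃ TBox × List Assertion where
  toFun K := (K.tbox, K.abox)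
  invFun p := ⟨p.1, p.2⟩
  left_inv _ := rfl
  right_inv _ := rfl

instance : Primcodable KB := Primcodable.ofEquiv _ KB.equivProd

/-- `ind(K)`, the set of individual names in the ABox. -/
def KB.inds (K : KB) : Set ℕ := {a | ∃ α ∈ K.abox, a ∈ α.inds}

/-- Interpretations. The standard name assumption (each individual name is interpreted by itself)
is expressed, up to renaming the elements of the domain, by an injective naming map. -/
structure Interp : Type 1 where
  Dom : Type
  name : ℕ → Dom
  name_injective : Function.Injective name
  conc : ℕ → Set Dom
  role : ℕ → Dom → Dom → Prop

namespace Interp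

/-- The extension of a concept. -/
def ext (I : Interp) : Concept → Set I.Dom
  | Concept.atom A => I.conc A
  | Concept.top => Set.univ
  | Concept.neg C => (I.ext C)ᶜ
  | Concept.inter C D => I.ext C ∩ I.ext D
  | Concept.ex R C => {d | ∃ e, I.role R d e ∧ e ∈ I.ext C}

/-- Truth of an assertion. -/
def SatAssertion (I : Interp) : Assertion → Prop
  | Assertion.conc A a => I.name a ∈ I.conc A
  | Assertion.role R a b => I.role R (I.name a) (I.name b)

/-- `I` is a model of `K`. -/
def IsModel (I : Interp) (K : KB) : Prop :=
  (∀ ci ∈ K.tbox, I.ext ci.1 ⊆ I.ext ci.2) ∧ ∀ α ∈ K.abox, I.SatAssertion α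

end Interp

/-- A knowledge base is consistent if it has a model. -/
def KB.Consistent (K : KB) : Prop := ∃ I : Interp, I.IsModel K

/-- A signature: a set of concept names and a set of role names. -/
structure Signature : Type where
  concs : Set ℕ
  roles : Set ℕ

/-- The full signature contains all concept and role names. -/
def Signature.full : Signature := ⟨Set.univ, Set.univ⟩

/-- The finite signature given by a list of concept names and a list of role names. -/
def Signature.ofLists (s : List ℕ × List ℕ) : Signature := ⟨{A | A ∈ s.1}, {R | R ∈ s.2}⟩

/-- The variables of a query with `k` answer variables `Sum.inl i`; the variables `Sum.inr j` are
existentially quantified. -/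
abbrev Var (k : ℕ) : Type := Fin k ⊕ ℕ

/-- Query atoms `A(z)` and `R(z, w)`. -/
inductive QAtom (k : ℕ) : Type
  | conc (A : ℕ) (z : Var k)
  | role (R : ℕ) (z w : Var k)

/-- Conjunctive queries with `k` answer variables. The existentially quantified variables are the
`Sum.inr j` that occur in the atoms. -/
structure CQ (k : ℕ) : Type where
  atoms : List (QAtom k)

namespace QAtom

/-- Truth of an atom under an assignment of domain elements to the variables. -/
def Sat {k : ℕ} (I : Interp) (h : Var k → I.Dom) : QAtom k → Prop
  | conc A z => h z ∈ I.conc A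
  | role R z w => I.role R (h z) (h w)

/-- The variables of an atom. -/
def vars {k : ℕ} : QAtom k → Set (Var k)
  | conc _ z => {z}
  | role _ z w => {z, w}

/-- The concept or role name of the atom belongs to `S`. -/
def Over {k : ℕ} (S : Signature) : QAtom k → Prop
  | conc A _ => A ∈ S.concs
  | role R _ _ => R ∈ S.roles

end QAtom

namespace CQ

/-- `I ⊨ q(a)` for a tuple `a` of individual names. -/
def Holds {k : ℕ} (q : CQ k) (I : Interp) (a : Fin k → ℕ) : Prop :=
  ∃ v : ℕ → I.Dom, ∀ α ∈ q.atoms, α.Sat I (Sum.elim (fun i => I.name (a i)) v)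

/-- `q` uses only names from `S`. -/
def Over {k : ℕ} (S : Signature) (q : CQ k) : Prop := ∀ α ∈ q.atoms, α.Over S

/-- `R(z, w)` is an atom of `q`, for some role name `R`. -/
def Edge {k : ℕ} (q : CQ k) (z w : Var k) : Prop := ∃ R : ℕ, QAtom.role R z w ∈ q.atoms

/-- `q` is rooted: every quantified variable of `q` is connected to an answer variable by a path
in the undirected graph of the role atoms. -/
def Rooted {k : ℕ} (q : CQ k) : Prop :=
  ∀ j : ℕ, (∃ α ∈ q.atoms, (Sum.inr j : Var k) ∈ α.vars) →
    ∃ i : Fin k, Relation.ReflTransGen (fun z w => q.Edge z w ∨ q.Edge w z) (Sum.inr j) (Sum.inl i)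

end CQ

/-- The two classes of queries: conjunctive queries and rooted conjunctive queries. -/
inductive QueryClass : Type
  | cq
  | rcq

/-- Membership of a conjunctive query in a class of queries. -/
def QueryClass.Contains : QueryClass → {k : ℕ} → CQ k → Prop
  | cq, _, _ => True
  | rcq, _, q => q.Rooted

namespace KB

/-- `K ⊨ q(a)`: the query holds at `a` in all models of `K`. -/
def Certain (K : KB) {k : ℕ} (q : CQ k) (a : Fin k → ℕ) : Prop :=
  ∀ I : Interp, I.IsModel K → q.Holds I a

/-- `K₁` `S`-`Q`-entails `K₂` (a notion for consistent knowledge bases). -/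
def QEntails (Q : QueryClass) (S : Signature) (K₁ K₂ : KB) : Prop :=
  ∀ (k : ℕ) (q : CQ k), Q.Contains q → q.Over S →
    ∀ a : Fin k → ℕ, (∀ i, a i ∈ K₂.inds) → K₂.Certain q a →
      (∀ i, a i ∈ K₁.inds) ∧ K₁.Certain q a

/-- `K₁` and `K₂` are `S`-`Q`-inseparable. -/
def QInseparable (Q : QueryClass) (S : Signature) (K₁ K₂ : KB) : Prop :=
  K₁.QEntails Q S K₂ ∧ K₂.QEntails Q S K₁

end KB

/-- The problem "given `x` with `Valid x`, does `Yes x` hold?" is decidable: some algorithm halts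
on every valid input and answers correctly there. Nothing is asked of it on other inputs. -/
def DecidableProblem {α : Type} [Primcodable α] (Valid Yes : α → Prop) : Prop :=
  ∃ f : α →. Bool, Partrec f ∧
    ∀ x, Valid x → (Yes x → true ∈ f x) ∧ (¬ Yes x → false ∈ f x)

end DL

/-!
Entailment is already undecidable between a knowledge base `(∅, A)` and its extension `(T, A)` by
an `ALC` TBox `T`. The empty TBox is both `EL` and Horn-`ALC`, and since `(T, A)` entails `(∅, A)`
anyway, entailment and inseparability coincide for such pairs. The halting problem is reduced to
the failure of entailment, in four stages.

*From knowledge bases to graphs.* A `CheckGraph` has a start node and marked, checked and final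
nodes. It is solvable if, for some number `d`, a walk from the start to a final node is such that
each of its checked nodes is preceded, `d` steps earlier, by a marked node. The TBox describes the
walks: in a model the role edges follow all walks, marked nodes carry the concept name `0`, and
final nodes the concept name `1`. At a checked node a model may choose, by a disjunction, to carry
the name `1` and to discontinue the walk. The nodes are represented by negated concept names, so
that a conjunctive query cannot ask for a node, even if it may use all names. If a solution with a
walk of length `m` exists, then the query "a path of length `m + 1` leads to the name `1`, and `d`
steps before its end there is the name `0`" is certain, because wherever the walk is discontinued
the node `d` steps earlier is marked; a role loop at the root compensates for walks that stop
early. The query fails in the ABox. If there is no solution, then for every `d` a model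
discontinues the walks exactly where the condition for `d` fails, so that in it no path of length
`d` leads from the name `0` to the name `1`. A certain query therefore has no directed path at all
from the name `0` to the name `1`, and every such query can be matched in the ABox, whose
individuals `1` and `2` absorb the variables with the name `1` and those reachable from the name
`0`. This is `CheckGraph.qEntails_iff`. The path query is rooted, so that both classes of queries
behave alike.

*From graphs to block systems.* Instead of the two properties "marked" and "checked", a
`BlockSystem` has nodes with a top colour and a bottom colour, to be compared at a fixed distance.
A block becomes a path of nodes in which colours are represented in unary. The distance `d` need
not be a multiple of the length of these paths in the first place; this is forced by a wall colour,
represented by two adjacent nodes (`BlockSystem.solvable_of_toGraph`).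

*From block systems to machines.* The sequence of blocks spells out the rows of a run of a cellular
automaton between two walls, each block after the first row being a triple of adjacent cells; the
comparison at the distance of one row makes sure that each row results from the row before
(`Automaton.exists_halting_of_tableau`). The automaton simulates a Turing machine
(`Machine.tableau_solvable_iff`).

*From machines to codes.* By the evaluation of partial recursive functions by Turing machines in
Mathlib there is a universal machine with finitely many states and symbols
(`Machine.exists_universal`). Only the input word depends on the code to be evaluated, so that the
knowledge bases are computable from the code.
-/

/-! ### Checked walks in a graph and their knowledge bases -/

namespace DL

/-- A directed graph with a start node in which some nodes are *marked*, some are *checked* and some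
are *final*. The checked nodes of a walk are compared with the nodes a fixed distance before. -/
structure CheckGraph (V : Type) where
  start : V
  edge : V → V → Prop
  marked : V → Prop
  checked : V → Prop
  final : V → Prop

/-- Some walk leads from the start node to a final node, and for some shift `d` every checked node
on it is preceded, `d` steps earlier, by a marked node. -/
def CheckGraph.Solvable {V : Type} (G : CheckGraph V) : Prop :=
  ∃ (d m : ℕ) (x : ℕ → V), x 0 = G.start ∧ (∀ i < m, G.edge (x i) (x (i + 1))) ∧ G.final (x m) ∧
    ∀ n ≤ m, G.checked (x n) → d ≤ n ∧ G.marked (x (n - d))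

namespace CheckGraph

/-- The concept "the current node has number `v`". It is the negation of a concept name, so that a
query can only express that the current node is *not* `v`. -/
def nodeConcept (v : ℕ) : Concept := .neg (.atom (v + 3))

/-- The disjunction of two concepts. -/
def orConcept (C D : Concept) : Concept := .neg (.inter (.neg C) (.neg D))

variable {V : Type} (G : CheckGraph V)

/-- The concept inclusions describing the walks of `G`. The concept name `0` holds at marked nodes.
The concept name `1` holds at final nodes; at a checked node it may be chosen to hold, and then the
walk need not go on. An individual with the concept name `2` starts the walks.
Only nodes from the set `live` are described; `code` numbers the nodes. -/
inductive IsAxiom (code : V → ℕ) (live : V → Prop) : Concept × Concept → Prop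
  | start : IsAxiom code live (.atom 2, .ex 0 (nodeConcept (code G.start)))
  | marked (v : V) : live v → G.marked v → IsAxiom code live (nodeConcept (code v), .atom 0)
  | free (v w : V) : live v → G.edge v w → ¬ G.checked v →
      IsAxiom code live (nodeConcept (code v), .ex 0 (nodeConcept (code w)))
  | guarded (v w : V) : live v → G.edge v w → G.checked v →
      IsAxiom code live (nodeConcept (code v),
        orConcept (.atom 1) (.ex 0 (nodeConcept (code w))))
  | final (v : V) : live v → G.final v → IsAxiom code live (nodeConcept (code v), .atom 1)

/-- The ABox on the individuals `0`, `1`, `2`. Individual `0` starts the walks and has role edges to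
all three individuals; `1` has the concept name `1` and no role successor; `2` has the concept name
`0` and itself as its only role successor. All three carry the names `v + 3` for `v < bound`. -/
def kbAbox (bound : ℕ) : List Assertion :=
  [.conc 2 0, .role 0 0 0, .role 0 0 1, .role 0 0 2, .role 0 2 2, .conc 1 1, .conc 0 2] ++
    (List.range bound).flatMap (fun v => [.conc (v + 3) 0, .conc (v + 3) 1, .conc (v + 3) 2])

theorem mem_kbAbox {bound : ℕ} {α : Assertion} : α ∈ kbAbox bound ↔
    (α = .conc 2 0 ∨ α = .role 0 0 0 ∨ α = .role 0 0 1 ∨ α = .role 0 0 2 ∨ α = .role 0 2 2 ∨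
      α = .conc 1 1 ∨ α = .conc 0 2) ∨ ∃ v < bound, ∃ i ≤ 2, α = .conc (v + 3) i := by
  simp only [kbAbox, List.mem_append, List.mem_cons, List.not_mem_nil, or_false, List.mem_flatMap,
    List.mem_range]
  refine or_congr Iff.rfl (exists_congr fun v => and_congr Iff.rfl ⟨?_, ?_⟩)
  · rintro (h | h | h)
    exacts [⟨0, by omega, h⟩, ⟨1, by omega, h⟩, ⟨2, by omega, h⟩]
  · rintro ⟨i, hi, h⟩
    interval_cases i <;> simp [h]

theorem kbAbox_inds_le {bound : ℕ} {T : TBox} {a : ℕ} (h : a ∈ (KB.mk T (kbAbox bound)).inds) :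
    a ≤ 2 := by
  obtain ⟨α, hα, ha⟩ := h
  rcases mem_kbAbox.1 hα with h | ⟨v, -, i, hi, rfl⟩
  · rcases h with rfl | rfl | rfl | rfl | rfl | rfl | rfl <;>
      simp only [Assertion.inds, Set.mem_insert_iff, Set.mem_singleton_iff] at ha <;> omega
  · simp only [Assertion.inds, Set.mem_singleton_iff] at ha
    omega

theorem zero_mem_inds (bound : ℕ) (T : TBox) : 0 ∈ (KB.mk T (kbAbox bound)).inds :=
  ⟨.conc 2 0, mem_kbAbox.2 (by simp), by simp [Assertion.inds]⟩

theorem mem_ext_nodeConcept (I : Interp) (v : ℕ) (e : I.Dom) :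
    e ∈ I.ext (nodeConcept v) ↔ e ∉ I.conc (v + 3) := by
  simp [nodeConcept, Interp.ext]

theorem mem_ext_orConcept (I : Interp) (C D : Concept) (e : I.Dom) :
    e ∈ I.ext (orConcept C D) ↔ e ∈ I.ext C ∨ e ∈ I.ext D := by
  simp only [orConcept, Interp.ext, Set.mem_compl_iff, Set.mem_inter_iff]
  tauto

/-- The models of the TBox, in terms of the extensions of the names. -/
theorem isModel_iff {code : V → ℕ} {live : V → Prop} {T : TBox} {A : List Assertion}
    (hT : ∀ ci, ci ∈ T ↔ G.IsAxiom code live ci) (I : Interp) :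
    I.IsModel ⟨T, A⟩ ↔
      (∀ e ∈ I.conc 2, ∃ e', I.role 0 e e' ∧ e' ∉ I.conc (code G.start + 3)) ∧
      (∀ v e, live v → e ∉ I.conc (code v + 3) →
        (G.marked v → e ∈ I.conc 0) ∧ (G.final v → e ∈ I.conc 1) ∧
        ∀ w, G.edge v w → (G.checked v ∧ e ∈ I.conc 1) ∨
          ∃ e', I.role 0 e e' ∧ e' ∉ I.conc (code w + 3)) ∧
      ∀ α ∈ A, I.SatAssertion α := by
  rw [Interp.IsModel, ← and_assoc]
  refine and_congr ⟨fun h => ⟨fun e he => ?_, fun v e hv he => ⟨fun hm => ?_, fun hf => ?_,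
    fun w hw => ?_⟩⟩, fun h => ?_⟩ Iff.rfl
  · obtain ⟨e', h1, h2⟩ := h _ ((hT _).2 .start) he
    exact ⟨e', h1, (mem_ext_nodeConcept ..).1 h2⟩
  · exact h _ ((hT _).2 (.marked v hv hm)) ((mem_ext_nodeConcept ..).2 he)
  · exact h _ ((hT _).2 (.final v hv hf)) ((mem_ext_nodeConcept ..).2 he)
  · by_cases hc : G.checked v
    · have := h _ ((hT _).2 (.guarded v w hv hw hc)) ((mem_ext_nodeConcept ..).2 he)
      rcases (mem_ext_orConcept ..).1 this with h1 | ⟨e', h1, h2⟩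
      · exact Or.inl ⟨hc, h1⟩
      · exact Or.inr ⟨e', h1, (mem_ext_nodeConcept ..).1 h2⟩
    · obtain ⟨e', h1, h2⟩ := h _ ((hT _).2 (.free v w hv hw hc)) ((mem_ext_nodeConcept ..).2 he)
      exact Or.inr ⟨e', h1, (mem_ext_nodeConcept ..).1 h2⟩
  · intro ci hci e he
    cases (hT ci).1 hci with
    | start =>
      obtain ⟨e', h1, h2⟩ := h.1 e he
      exact ⟨e', h1, (mem_ext_nodeConcept ..).2 h2⟩
    | marked v hv hm => exact (h.2 v e hv ((mem_ext_nodeConcept ..).1 he)).1 hm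
    | final v hv hf => exact (h.2 v e hv ((mem_ext_nodeConcept ..).1 he)).2.1 hf
    | free v w hv hw hc =>
      rcases (h.2 v e hv ((mem_ext_nodeConcept ..).1 he)).2.2 w hw with h1 | ⟨e', h1, h2⟩
      · exact absurd h1.1 hc
      · exact ⟨e', h1, (mem_ext_nodeConcept ..).2 h2⟩
    | guarded v w hv hw hc =>
      refine (mem_ext_orConcept ..).2 ?_
      rcases (h.2 v e hv ((mem_ext_nodeConcept ..).1 he)).2.2 w hw with h1 | ⟨e', h1, h2⟩
      · exact Or.inl h1.2
      · exact Or.inr ⟨e', h1, (mem_ext_nodeConcept ..).2 h2⟩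

theorem consistent_tbox {code : V → ℕ} {live : V → Prop} {T : TBox}
    (hT : ∀ ci, ci ∈ T ↔ G.IsAxiom code live ci) (bound : ℕ) :
    (KB.mk T (kbAbox bound)).Consistent := by
  -- Every node concept holds at `3`, and the role and the names `0`, `1`, `2` hold everywhere.
  let I : Interp :=
    { Dom := ℕ, name := id, name_injective := Function.injective_id
      conc := fun A => {e | A < 3 ∨ e ≤ 2}, role := fun _ _ _ => True }
  refine ⟨I, (G.isModel_iff hT I).2 ⟨fun e _ => ⟨(3 : ℕ), trivial, ?_⟩, fun v e _ _ =>
    ⟨fun _ => ?_, fun _ => ?_, fun w _ => Or.inr ⟨(3 : ℕ), trivial, ?_⟩⟩, fun α hα => ?_⟩⟩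
  · simp [I]
  · exact Or.inl (by norm_num)
  · exact Or.inl (by norm_num)
  · simp [I]
  · rcases mem_kbAbox.1 hα with h | ⟨v, -, i, hi, rfl⟩
    · rcases h with rfl | rfl | rfl | rfl | rfl | rfl | rfl <;>
        simp [Interp.SatAssertion, I]
    · exact Or.inr hi

/-- The variables of `pathQuery`: the answer variable, followed by quantified variables. -/
def pathVar : ℕ → Var 1
  | 0 => Sum.inl 0
  | n + 1 => Sum.inr n

/-- The query "a path of length `m` leads from the answer variable to an element with the concept
name `1`, and the element `d` steps before the end has the concept name `0`". -/
def pathQuery (d m : ℕ) : CQ 1 :=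
  ⟨(List.range m).map (fun i => .role 0 (pathVar i) (pathVar (i + 1))) ++
    [.conc 0 (pathVar (m - d)), .conc 1 (pathVar m)]⟩

theorem mem_pathQuery {d m : ℕ} {α : QAtom 1} : α ∈ (pathQuery d m).atoms ↔
    (∃ i < m, α = .role 0 (pathVar i) (pathVar (i + 1))) ∨ α = .conc 0 (pathVar (m - d)) ∨
      α = .conc 1 (pathVar m) := by
  simp [pathQuery, eq_comm]

theorem pathQuery_over (d m : ℕ) : (pathQuery d m).Over (Signature.ofLists ([0, 1], [0])) := by
  intro α hα
  rcases mem_pathQuery.1 hα with ⟨i, -, rfl⟩ | rfl | rfl <;>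
    simp [QAtom.Over, Signature.ofLists]

theorem pathQuery_rooted (d m : ℕ) : (pathQuery d m).Rooted := by
  have key : ∀ i ≤ m, Relation.ReflTransGen
      (fun z w => (pathQuery d m).Edge z w ∨ (pathQuery d m).Edge w z)
      (pathVar i) (Sum.inl 0) := by
    intro i
    induction i with
    | zero => exact fun _ => .refl
    | succ i ih =>
      exact fun hi => .head (Or.inr ⟨0, mem_pathQuery.2 (Or.inl ⟨i, hi, rfl⟩)⟩) (ih (by omega))
  have hvar : ∀ i ≤ m, ∀ j, (Sum.inr j : Var 1) = pathVar i → j + 1 ≤ m := by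
    rintro (_ | i) hi j h
    · simp [pathVar] at h
    · simp only [pathVar, Sum.inr.injEq] at h
      omega
  rintro j ⟨α, hα, hj⟩
  refine ⟨0, key (j + 1) ?_⟩
  rcases mem_pathQuery.1 hα with ⟨i, hi, rfl⟩ | rfl | rfl
  · rcases hj with hj | hj
    exacts [hvar i hi.le j hj, hvar (i + 1) hi j hj]
  · exact hvar _ (Nat.sub_le ..) j hj
  · exact hvar m le_rfl j hj

/-- In a model the walk `x` can be followed until the concept name `1` is met at a checked node. -/
theorem exists_path_of_isModel {code : V → ℕ} {live : V → Prop} {T : TBox} {bound : ℕ}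
    (hT : ∀ ci, ci ∈ T ↔ G.IsAxiom code live ci) (hfin : ∀ v, G.final v → G.checked v)
    {m : ℕ} {x : ℕ → V} (h0 : x 0 = G.start) (hE : ∀ i < m, G.edge (x i) (x (i + 1)))
    (hlive : ∀ i ≤ m, live (x i)) (hm : G.final (x m)) {I : Interp}
    (hI : I.IsModel ⟨T, kbAbox bound⟩) :
    ∃ (k : ℕ) (e : ℕ → I.Dom), k ≤ m ∧ e 0 = I.name 0 ∧
      (∀ i ≤ k, I.role 0 (e i) (e (i + 1)) ∧ e (i + 1) ∉ I.conc (code (x i) + 3)) ∧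
      e (k + 1) ∈ I.conc 1 ∧ G.checked (x k) := by
  obtain ⟨hstart, hax, habox⟩ := (G.isModel_iff hT I).1 hI
  by_contra hcon
  have key : ∀ n ≤ m, ∃ e : ℕ → I.Dom, e 0 = I.name 0 ∧
      ∀ i ≤ n, I.role 0 (e i) (e (i + 1)) ∧ e (i + 1) ∉ I.conc (code (x i) + 3) := by
    intro n
    induction n with
    | zero =>
      intro _
      obtain ⟨e', h1, h2⟩ := hstart (I.name 0) (habox (.conc 2 0) (mem_kbAbox.2 (by simp)))
      refine ⟨fun i => if i = 0 then I.name 0 else e', rfl, fun i hi => ?_⟩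
      obtain rfl : i = 0 := by omega
      simpa [h0] using ⟨h1, h2⟩
    | succ n ih =>
      intro hn
      obtain ⟨e, he0, he⟩ := ih (by omega)
      rcases (hax _ _ (hlive n (by omega)) (he n le_rfl).2).2.2 _ (hE n (by omega)) with
        ⟨hc, hb⟩ | ⟨e', h1, h2⟩
      · exact absurd ⟨n, e, by omega, he0, he, hb, hc⟩ hcon
      · refine ⟨fun i => if i ≤ n + 1 then e i else e', by simpa using he0, fun i hi => ?_⟩
        rcases Nat.lt_or_ge n i with h | h
        · obtain rfl : i = n + 1 := by omega
          simpa using ⟨h1, h2⟩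
        · have h3 : i ≤ n + 1 := by omega
          simpa [h3, h] using he i h
  obtain ⟨e, he0, he⟩ := key m le_rfl
  exact hcon ⟨m, e, le_rfl, he0, he, (hax _ _ (hlive m le_rfl) (he m le_rfl).2).2.1 hm,
    hfin _ hm⟩

theorem live_walk {live : V → Prop} (hstart : live G.start)
    (hlive : ∀ v w, live v → G.edge v w → live w) {m : ℕ} {x : ℕ → V} (h0 : x 0 = G.start)
    (hE : ∀ i < m, G.edge (x i) (x (i + 1))) : ∀ i ≤ m, live (x i) := by
  intro i
  induction i with
  | zero => exact fun _ => h0 ▸ hstart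
  | succ i ih => exact fun hi => hlive _ _ (ih (by omega)) (hE i hi)

/-- A solution of the graph problem with shift `d` makes `pathQuery d` certain: wherever a model
stops the walk by choosing the concept name `1`, the element `d` steps earlier is marked. The role
loop at individual `0` makes up for the different lengths of the stopped walks. -/
theorem certain_pathQuery {code : V → ℕ} {live : V → Prop} {T : TBox} {bound : ℕ}
    (hT : ∀ ci, ci ∈ T ↔ G.IsAxiom code live ci) (hfin : ∀ v, G.final v → G.checked v)
    (hstart : live G.start) (hlive : ∀ v w, live v → G.edge v w → live w)
    {d m : ℕ} {x : ℕ → V} (h0 : x 0 = G.start) (hE : ∀ i < m, G.edge (x i) (x (i + 1)))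
    (hm : G.final (x m)) (hc : ∀ n ≤ m, G.checked (x n) → d ≤ n ∧ G.marked (x (n - d))) :
    (KB.mk T (kbAbox bound)).Certain (pathQuery d (m + 1)) (fun _ => 0) := by
  intro I hI
  have hl := G.live_walk hstart hlive h0 hE
  obtain ⟨k, e, hk, he0, he, hb, hck⟩ := G.exists_path_of_isModel hT hfin h0 hE hl hm hI
  obtain ⟨-, hax, habox⟩ := (G.isModel_iff hT I).1 hI
  obtain ⟨hd, hmark⟩ := hc k hk hck
  have hloop : I.role 0 (I.name 0) (I.name 0) := habox (.role 0 0 0) (mem_kbAbox.2 (by simp))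
  refine ⟨fun j => e (j + 1 - (m - k)), fun α hα => ?_⟩
  have hval : ∀ i, (Sum.elim (fun _ => I.name 0) (fun j => e (j + 1 - (m - k))) (pathVar i) : I.Dom)
      = e (i - (m - k)) := by
    rintro (_ | i)
    · simp [pathVar, he0]
    · rfl
  rcases mem_pathQuery.1 hα with ⟨i, hi, rfl⟩ | rfl | rfl
  · simp only [QAtom.Sat, hval]
    rcases Nat.lt_or_ge i (m - k) with h | h
    · rw [Nat.sub_eq_zero_of_le h.le, Nat.sub_eq_zero_of_le h, he0]
      exact hloop
    · rw [show i + 1 - (m - k) = (i - (m - k)) + 1 by omega]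
      exact (he _ (by omega)).1
  · simp only [QAtom.Sat, hval]
    rw [show m + 1 - d - (m - k) = (k - d) + 1 by omega]
    exact (hax _ _ (hl _ (by omega)) (he _ (Nat.sub_le ..)).2).1 hmark
  · simp only [QAtom.Sat, hval]
    rw [show m + 1 - (m - k) = k + 1 by omega]
    exact hb

/-- The ABox read as an interpretation. -/
def aboxInterp : Interp where
  Dom := ℕ
  name := id
  name_injective := Function.injective_id
  conc A := {e | (A = 0 ∧ e = 2) ∨ (A = 1 ∧ e = 1) ∨ (A = 2 ∧ e = 0) ∨ 3 ≤ A}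
  role _ e e' := (e = 0 ∧ e' ≤ 2) ∨ (e = 2 ∧ e' = 2)

theorem aboxInterp_isModel (bound : ℕ) : aboxInterp.IsModel ⟨[], kbAbox bound⟩ := by
  refine ⟨by simp, fun α hα => ?_⟩
  rcases mem_kbAbox.1 hα with h | ⟨v, -, i, hi, rfl⟩
  · rcases h with rfl | rfl | rfl | rfl | rfl | rfl | rfl <;>
      simp [Interp.SatAssertion, aboxInterp] <;> rfl
  · exact Or.inr (Or.inr (Or.inr (Nat.le_add_left 3 v)))

theorem not_certain_pathQuery (bound d m : ℕ) (a : Fin 1 → ℕ) :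
    ¬ (KB.mk [] (kbAbox bound)).Certain (pathQuery d m) a := by
  intro h
  obtain ⟨v, hv⟩ := h _ (aboxInterp_isModel bound)
  set y : ℕ → ℕ := fun i => Sum.elim (fun i => aboxInterp.name (a i)) v (pathVar i) with hy
  have h0 : y (m - d) = 2 := by
    rcases hv _ (mem_pathQuery.2 (Or.inr (Or.inl rfl))) with h | h | h | h
    exacts [h.2, by omega, by omega, by omega]
  have h1 : y m = 1 := by
    rcases hv _ (mem_pathQuery.2 (Or.inr (Or.inr rfl))) with h | h | h | h
    exacts [by omega, h.2, by omega, by omega]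
  have key : ∀ i, m - d + i ≤ m → y (m - d + i) = 2 := by
    intro i
    induction i with
    | zero => exact fun _ => h0
    | succ i ih =>
      intro hi
      have h2 : (y (m - d + i) = 0 ∧ y (m - d + i + 1) ≤ 2) ∨
          (y (m - d + i) = 2 ∧ y (m - d + i + 1) = 2) :=
        hv _ (mem_pathQuery.2 (Or.inl ⟨m - d + i, by omega, rfl⟩))
      have h3 := ih (by omega)
      rw [← add_assoc]
      omega
  have := key (m - (m - d)) (by omega)
  rw [show m - d + (m - (m - d)) = m by omega] at this
  omega

/-- The node reached by the walk `x` after `n` steps is stopped, for the shift `d`: it is checked,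
but the node `d` steps earlier is not marked. -/
def Stopped (d n : ℕ) (x : ℕ → V) : Prop :=
  G.checked (x n) ∧ ¬ (d ≤ n ∧ G.marked (x (n - d)))

/-- The first `n` steps of `x` are a walk from the start that is not stopped before its end. -/
def Reached (d n : ℕ) (x : ℕ → V) : Prop :=
  x 0 = G.start ∧ ∀ i < n, G.edge (x i) (x (i + 1)) ∧ ¬ G.Stopped d i x

/-- The model that refutes `pathQuery d`. Its domain consists of the individuals and of the walks
`(n, x)` of length `n`, where `x` is irrelevant beyond `n`. The concept name `1` is
chosen exactly at the stopped nodes. -/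
def stopInterp (code : V → ℕ) (bound d : ℕ) : Interp where
  Dom := ℕ ⊕ (ℕ × (ℕ → V))
  name := Sum.inl
  name_injective := Sum.inl_injective
  conc A := {e | match e with
    | Sum.inl i => (A = 0 ∧ i = 2) ∨ (A = 1 ∧ i = 1) ∨ (A = 2 ∧ i = 0) ∨ (3 ≤ A ∧ A < bound + 3)
    | Sum.inr (n, x) => (A = 0 ∧ G.marked (x n)) ∨ (A = 1 ∧ G.Stopped d n x) ∨
        (3 ≤ A ∧ A < bound + 3 ∧ ¬ (G.Reached d n x ∧ A = code (x n) + 3))}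
  role R e e' := R = 0 ∧ match e, e' with
    | Sum.inl i, Sum.inl j => (i = 0 ∧ j ≤ 2) ∨ (i = 2 ∧ j = 2)
    | Sum.inl i, Sum.inr (n, x) => i = 0 ∧ n = 0 ∧ G.Reached d n x
    | Sum.inr _, Sum.inl _ => False
    | Sum.inr (n, x), Sum.inr (n', x') => n' = n + 1 ∧ (∀ i ≤ n, x' i = x i) ∧ G.Reached d n' x'

theorem stopInterp_isModel {code : V → ℕ} {live : V → Prop} {T : TBox} {bound : ℕ}
    (hcode : Function.Injective code) (hbound : ∀ v, live v → code v < bound)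
    (hT : ∀ ci, ci ∈ T ↔ G.IsAxiom code live ci) (hns : ¬ G.Solvable) (d : ℕ) :
    (G.stopInterp code bound d).IsModel ⟨T, kbAbox bound⟩ := by
  have hnode : ∀ v, live v → ∀ e, e ∉ (G.stopInterp code bound d).conc (code v + 3) →
      ∃ n x, e = Sum.inr (n, x) ∧ G.Reached d n x ∧ x n = v := by
    intro v hv e he
    rcases e with i | ⟨n, x⟩
    · exact absurd (Or.inr (Or.inr (Or.inr ⟨by omega, by have := hbound v hv; omega⟩))) he
    · by_contra hcon
      refine he (Or.inr (Or.inr ⟨by omega, by have := hbound v hv; omega, fun h => ?_⟩))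
      exact hcon ⟨n, x, rfl, h.1, hcode (by omega)⟩
  have hnode' : ∀ n x, G.Reached d n x →
      (Sum.inr (n, x) : ℕ ⊕ (ℕ × (ℕ → V))) ∉
        (G.stopInterp code bound d).conc (code (x n) + 3) := by
    rintro n x hx (⟨h, -⟩ | ⟨h, -⟩ | ⟨-, -, h⟩)
    · omega
    · omega
    · exact h ⟨hx, rfl⟩
  refine (G.isModel_iff hT _).2 ⟨fun e he => ?_, fun v e hv he => ?_, fun α hα => ?_⟩
  · rcases e with i | ⟨n, x⟩
    · obtain rfl : i = 0 := by
        rcases he with h | h | h | h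
        all_goals omega
      have hr : G.Reached d 0 (fun _ => G.start) := ⟨rfl, by simp⟩
      exact ⟨Sum.inr (0, fun _ => G.start), ⟨rfl, rfl, rfl, hr⟩, hnode' 0 _ hr⟩
    · rcases he with h | h | h
      all_goals omega
  · obtain ⟨n, x, rfl, hr, rfl⟩ := hnode v hv e he
    refine ⟨fun hm => Or.inl ⟨rfl, hm⟩, fun hf => Or.inr (Or.inl ⟨rfl, ?_⟩), fun w hw => ?_⟩
    · by_contra hns'
      refine hns ⟨d, n, x, hr.1, fun i hi => (hr.2 i hi).1, hf, fun k hk hck => ?_⟩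
      by_contra hcon
      rcases hk.lt_or_eq with h | rfl
      exacts [(hr.2 k h).2 ⟨hck, hcon⟩, hns' ⟨hck, hcon⟩]
    · by_cases hs : G.Stopped d n x
      · exact Or.inl ⟨hs.1, Or.inr (Or.inl ⟨rfl, hs⟩)⟩
      · set x' : ℕ → V := fun i => if i ≤ n then x i else w with hx'
        have hle : ∀ i ≤ n, x' i = x i := fun i hi => if_pos hi
        have hlast : x' (n + 1) = w := if_neg (by omega)
        have hr' : G.Reached d (n + 1) x' := by
          refine ⟨(hle 0 (Nat.zero_le _)).trans hr.1, fun i hi => ?_⟩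
          have hst : G.Stopped d i x' ↔ G.Stopped d i x := by
            rw [Stopped, Stopped, hle i (by omega), hle (i - d) (by omega)]
          rw [hst, hle i (by omega)]
          rcases Nat.lt_or_ge i n with h | h
          · rw [hle (i + 1) h]
            exact hr.2 i h
          · obtain rfl : i = n := by omega
            exact ⟨hlast ▸ hw, hs⟩
        exact Or.inr ⟨Sum.inr (n + 1, x'), ⟨rfl, rfl, hle, hr'⟩, hlast ▸ hnode' _ _ hr'⟩
  · rcases mem_kbAbox.1 hα with h | ⟨v, hv, i, hi, rfl⟩
    · rcases h with rfl | rfl | rfl | rfl | rfl | rfl | rfl <;>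
        simp [Interp.SatAssertion, stopInterp] <;> rfl
    · exact Or.inr (Or.inr (Or.inr ⟨by omega, by omega⟩))

/-- In the refuting model for the shift `d` no path of length `d` leads from the concept name `0`
to the concept name `1`. -/
theorem stopInterp_no_path {code : V → ℕ} {bound d : ℕ} (y : ℕ → (G.stopInterp code bound d).Dom)
    (hstep : ∀ i < d, (G.stopInterp code bound d).role 0 (y i) (y (i + 1)))
    (h0 : y 0 ∈ (G.stopInterp code bound d).conc 0)
    (h1 : y d ∈ (G.stopInterp code bound d).conc 1) : False := by
  rcases hy : y 0 with i | ⟨n, x⟩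
  · -- The individual with the name `0` is its own only successor.
    have key : ∀ j ≤ d, y j = Sum.inl 2 := by
      intro j
      induction j with
      | zero =>
        intro _
        rw [hy] at h0 ⊢
        rcases h0 with h | h | h | h
        exacts [congrArg _ h.2, by omega, by omega, by omega]
      | succ j ih =>
        intro hj
        have h := hstep j (by omega)
        rw [ih (by omega)] at h
        rcases hy' : y (j + 1) with i' | ⟨n', x'⟩
        · rw [hy'] at h
          rcases h.2 with h | h
          exacts [by omega, congrArg _ h.2]
        · rw [hy'] at h
          exact absurd h.2.1 (by norm_num)
    rw [key d le_rfl] at h1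
    rcases h1 with h | h | h | h
    all_goals omega
  · have key : ∀ j ≤ d, ∃ x', y j = Sum.inr (n + j, x') ∧ ∀ i ≤ n, x' i = x i := by
      intro j
      induction j with
      | zero => exact fun _ => ⟨x, hy, fun _ _ => rfl⟩
      | succ j ih =>
        intro hj
        obtain ⟨x', hx', hxx⟩ := ih (by omega)
        have h := hstep j (by omega)
        rw [hx'] at h
        rcases hy' : y (j + 1) with i' | ⟨n'', x''⟩
        · rw [hy'] at h
          exact h.2.elim
        · rw [hy'] at h
          obtain ⟨-, rfl, h2, -⟩ := h
          exact ⟨x'', rfl, fun i hi => (h2 i (by omega)).trans (hxx i hi)⟩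
    obtain ⟨x', hx', hxx⟩ := key d le_rfl
    rw [hy] at h0
    rw [hx'] at h1
    have hm : G.marked (x n) := by
      rcases h0 with h | h | h
      exacts [h.2, by omega, by omega]
    have hs : G.Stopped d (n + d) x' := by
      rcases h1 with h | h | h
      exacts [by omega, h.2, by omega]
    refine hs.2 ⟨Nat.le_add_left .., ?_⟩
    rw [Nat.add_sub_cancel, hxx n le_rfl]
    exact hm

/-- Stopped nodes have no successor in the refuting model. -/
theorem stopInterp_no_succ {code : V → ℕ} {bound d : ℕ} {e e' : (G.stopInterp code bound d).Dom}
    (he : e ∈ (G.stopInterp code bound d).conc 1) {R : ℕ} :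
    ¬ (G.stopInterp code bound d).role R e e' := by
  rintro ⟨-, h⟩
  rcases e with i | ⟨n, x⟩
  · obtain rfl : i = 1 := by
      rcases he with h | h | h | h
      all_goals omega
    rcases e' with j | ⟨n, x⟩
    · rcases h with h | h
      all_goals omega
    · exact absurd h.1 one_ne_zero
  · have hs : G.Stopped d n x := by
      rcases he with h | h | h
      exacts [by omega, h.2, by omega]
    rcases e' with j | ⟨n', x'⟩
    · exact h
    · obtain ⟨rfl, hx, hr⟩ := h
      refine (hr.2 n (Nat.lt_succ_self n)).2 ?_
      rw [Stopped, hx n le_rfl, hx (n - d) (Nat.sub_le ..)]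
      exact hs

/-- If the graph problem has no solution, then a query that is certain for the full knowledge base
is certain for its ABox. By the refuting models, such a query has no path from a variable with the
name `0` to a variable with the name `1`; so it can be matched in the ABox, with the variables
reachable from the name `0` sent to individual `2`, those with the name `1` sent to individual `1`,
and the other ones to individual `0`. -/
theorem certain_abox_of_certain {code : V → ℕ} {live : V → Prop} {T : TBox} {bound : ℕ}
    (hcode : Function.Injective code) (hbound : ∀ v, live v → code v < bound)
    (hT : ∀ ci, ci ∈ T ↔ G.IsAxiom code live ci)
    (hns : ¬ G.Solvable) {k : ℕ} (q : CQ k) (a : Fin k → ℕ)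
    (ha : ∀ i, a i ∈ (KB.mk T (kbAbox bound)).inds)
    (hq : (KB.mk T (kbAbox bound)).Certain q a) :
    (KB.mk [] (kbAbox bound)).Certain q a := by
  classical
  have hmod := G.stopInterp_isModel hcode hbound hT hns
  have hpath : ∀ (d : ℕ) (y : ℕ → Var k), (∀ i < d, q.Edge (y i) (y (i + 1))) →
      .conc 0 (y 0) ∈ q.atoms → .conc 1 (y d) ∈ q.atoms → False := by
    intro d y hy h0 h1
    obtain ⟨v, hv⟩ := hq _ (hmod d)
    refine G.stopInterp_no_path (fun i => Sum.elim _ v (y i)) (fun i hi => ?_) (hv _ h0) (hv _ h1)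
    obtain ⟨R, hR⟩ := hy i hi
    have := hv _ hR
    obtain rfl : R = 0 := this.1
    exact this
  have hreach : ∀ z w, Relation.ReflTransGen q.Edge z w → .conc 0 z ∈ q.atoms →
      .conc 1 w ∉ q.atoms := by
    intro z w hzw h0 h1
    have : ∃ (d : ℕ) (y : ℕ → Var k), y 0 = z ∧ y d = w ∧ ∀ i < d, q.Edge (y i) (y (i + 1)) := by
      clear h1
      induction hzw with
      | refl => exact ⟨0, fun _ => z, rfl, rfl, by simp⟩
      | @tail w w' _ hww ih =>
        obtain ⟨d, y, y0, yd, hy⟩ := ih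
        refine ⟨d + 1, fun i => if i ≤ d then y i else w', by simpa using y0, by simp,
          fun i hi => ?_⟩
        rcases Nat.lt_or_ge i d with h | h
        · simpa [h, h.le, Nat.succ_le_of_lt h] using hy i h
        · obtain rfl : i = d := by omega
          simpa [yd] using hww
    obtain ⟨d, y, rfl, rfl, hy⟩ := this
    exact hpath d y hy h0 h1
  let I := G.stopInterp code bound 0
  obtain ⟨v, hv⟩ : q.Holds I a := hq _ (hmod 0)
  let h : Var k → I.Dom := Sum.elim (fun i => I.name (a i)) v
  -- The variables that have to be sent to individuals `1` and `2`.
  let ends : Var k → Prop := fun z => .conc 1 z ∈ q.atoms ∨ h z = Sum.inl 1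
  let loops : Var k → Prop := fun z =>
    (∃ z', .conc 0 z' ∈ q.atoms ∧ Relation.ReflTransGen q.Edge z' z) ∨ h z = Sum.inl 2
  let g : Var k → ℕ := fun z => if loops z then 2 else if ends z then 1 else 0
  have hname : ∀ z, ends z → h z ∈ I.conc 1 := by
    rintro z (hz | hz)
    · exact hv _ hz
    · rw [hz]
      exact Or.inr (Or.inl ⟨rfl, rfl⟩)
  have hinto : ∀ e i, i ≤ 1 → I.role 0 e (Sum.inl i) → e = Sum.inl 0 := by
    rintro (j | ⟨n, x⟩) i hi ⟨-, hr⟩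
    · rcases hr with hr | hr
      exacts [congrArg _ hr.1, by omega]
    · exact hr.elim
  have hroleR : ∀ {R z w}, .role R z w ∈ q.atoms → R = 0 ∧ I.role 0 (h z) (h w) := by
    intro R z w hR
    have := hv _ hR
    obtain rfl : R = 0 := this.1
    exact ⟨rfl, this⟩
  have h0conc : ∀ i, (Sum.inl i : ℕ ⊕ (ℕ × (ℕ → V))) ∈ I.conc 0 → i = 2 := by
    rintro i (hi | hi | hi | hi)
    exacts [hi.2, by omega, by omega, by omega]
  -- A variable reachable from the name `0` is not matched to individual `0` or `1`: the only
  -- predecessor of these is individual `0`, and neither has the name `0`.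
  have hsmall : ∀ z, loops z → ∀ i ≤ 1, h z ≠ Sum.inl i := by
    rintro z (⟨z', hz', hr⟩ | hz) i hi hzi
    · induction hr generalizing i with
      | refl =>
        have h1 : h z' ∈ I.conc 0 := hv _ hz'
        rw [hzi] at h1
        have := h0conc i h1
        omega
      | tail _ hww ih =>
        obtain ⟨R, hR⟩ := hww
        have hR' := (hroleR hR).2
        rw [hzi] at hR'
        exact ih 0 (by omega) (hinto _ i hi hR')
    · rw [hz] at hzi
      have := Sum.inl_injective hzi
      omega
  have hdisj : ∀ z, loops z → ¬ ends z := by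
    rintro z hl (hz | hz)
    · rcases hl with ⟨z', hz', hr⟩ | hl
      · exact hreach z' z hr hz' hz
      · have h1 : h z ∈ I.conc 1 := hv _ hz
        rw [hl] at h1
        rcases h1 with h1 | h1 | h1 | h1
        all_goals omega
    · exact hsmall z hl 1 le_rfl hz
  have hind : ∀ z i, i ≤ 2 → h z = Sum.inl i → g z = i := by
    intro z i hi hz
    by_cases hl : loops z
    · have := hsmall z hl i
      have hg : g z = 2 := if_pos hl
      by_contra hcon
      exact this (by omega) hz
    · by_cases he : ends z
      · have hg : g z = 1 := by simp only [g, if_neg hl, if_pos he]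
        have h1 := hname z he
        rw [hz] at h1
        rcases h1 with h1 | h1 | h1 | h1
        all_goals omega
      · have hg : g z = 0 := by simp only [g, if_neg hl, if_neg he]
        rw [hg]
        by_contra hcon
        obtain rfl | rfl : i = 1 ∨ i = 2 := by omega
        exacts [he (Or.inr hz), hl (Or.inr hz)]
  have hg2 : ∀ z, g z ≤ 2 := by
    intro z
    simp only [g]
    split_ifs <;> omega
  intro J hJ
  refine ⟨fun j => J.name (g (Sum.inr j)), fun α hα => ?_⟩
  have hval : ∀ z, (Sum.elim (fun i => J.name (a i)) (fun j => J.name (g (Sum.inr j))) z : J.Dom)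
      = J.name (g z) := by
    rintro (i | j)
    · exact congrArg _ (hind _ _ (kbAbox_inds_le (ha i)) rfl).symm
    · rfl
  cases α with
  | conc A z =>
    simp only [QAtom.Sat, hval]
    suffices .conc A (g z) ∈ kbAbox bound from hJ.2 _ this
    refine mem_kbAbox.2 ?_
    have hz : h z ∈ I.conc A := hv _ hα
    rcases Nat.lt_or_ge A 3 with hA | hA
    · interval_cases A
      · have : g z = 2 := if_pos (Or.inl ⟨z, hα, .refl⟩)
        simp [this]
      · have he : ends z := Or.inl hα
        have : g z = 1 := by simp only [g, if_neg fun hl => hdisj z hl he, if_pos he]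
        simp [this]
      · rcases hhz : h z with i | ⟨n, x⟩
        · rw [hhz] at hz
          obtain rfl : i = 0 := by
            rcases hz with hz | hz | hz | hz
            all_goals omega
          simp [hind z 0 (by omega) hhz]
        · rw [hhz] at hz
          rcases hz with hz | hz | hz
          all_goals omega
    · have hAb : A < bound + 3 := by
        rcases hhz : h z with i | ⟨n, x⟩
        · rw [hhz] at hz
          rcases hz with hz | hz | hz | hz
          all_goals omega
        · rw [hhz] at hz
          rcases hz with hz | hz | hz
          all_goals omega
      exact Or.inr ⟨A - 3, by omega, g z, hg2 z, by rw [Nat.sub_add_cancel hA]⟩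
  | role R z w =>
    simp only [QAtom.Sat, hval]
    obtain ⟨rfl, hR⟩ := hroleR hα
    suffices .role 0 (g z) (g w) ∈ kbAbox bound from hJ.2 _ this
    refine mem_kbAbox.2 (Or.inl ?_)
    have hends : ¬ ends z := fun he => G.stopInterp_no_succ (hname z he) hR
    by_cases hl : loops z
    · have hlw : loops w := by
        rcases hl with ⟨z', hz', hr⟩ | hl
        · exact Or.inl ⟨z', hz', hr.tail ⟨0, hα⟩⟩
        · rw [hl] at hR
          rcases hhw : h w with i | ⟨n, x⟩
          · rw [hhw] at hR
            rcases hR.2 with hR | hR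
            · omega
            · exact Or.inr (by rw [hhw, hR.2])
          · rw [hhw] at hR
            exact absurd hR.2.1 (by norm_num)
      simp [g, if_pos hl, if_pos hlw]
    · have h0 : g z = 0 := by simp only [g, if_neg hl, if_neg hends]
      have := hg2 w
      rw [h0]
      interval_cases g w <;> simp

/-- The two knowledge bases decide solvability of the graph problem, whatever the class of queries
and for every signature that contains the concept names `0`, `1` and the role name `0`. -/
theorem qEntails_iff {code : V → ℕ} {live : V → Prop} {T : TBox} {bound : ℕ}
    (hcode : Function.Injective code) (hbound : ∀ v, live v → code v < bound)
    (hT : ∀ ci, ci ∈ T ↔ G.IsAxiom code live ci) (hfin : ∀ v, G.final v → G.checked v)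
    (hstart : live G.start) (hlive : ∀ v w, live v → G.edge v w → live w)
    (Q : QueryClass) (S : Signature)
    (hS : ∀ d m, (pathQuery d m).Over S) :
    (KB.mk [] (kbAbox bound)).QEntails Q S (KB.mk T (kbAbox bound)) ↔ ¬ G.Solvable := by
  constructor
  · rintro h ⟨d, m, x, h0, hE, hm, hc⟩
    have hQ : Q.Contains (pathQuery d (m + 1)) := by
      cases Q
      exacts [trivial, pathQuery_rooted d (m + 1)]
    exact not_certain_pathQuery bound d (m + 1) _
      (h 1 (pathQuery d (m + 1)) hQ (hS d (m + 1)) (fun _ => 0) (fun _ => zero_mem_inds bound T)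
        (G.certain_pathQuery hT hfin hstart hlive h0 hE hm hc)).2
  · exact fun hns k q _ _ a ha hq => ⟨ha,
      G.certain_abox_of_certain hcode hbound hT hns q a ha hq⟩

theorem isModel_abox_of_isModel {T : TBox} {A : List Assertion} {I : Interp}
    (h : I.IsModel ⟨T, A⟩) : I.IsModel ⟨[], A⟩ :=
  ⟨by simp, h.2⟩

theorem qEntails_abox (Q : QueryClass) (S : Signature) (T : TBox) (A : List Assertion) :
    (KB.mk T A).QEntails Q S (KB.mk [] A) :=
  fun _ _ _ _ _ ha hq => ⟨ha, fun I hI => hq I (isModel_abox_of_isModel hI)⟩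

end CheckGraph
end DL

/-! ### Comparing blocks of nodes at a fixed distance -/

namespace DL

/-- A graph whose nodes (*blocks*) may carry a *top* colour and a *bottom* colour, in which the
bottom colour of a block is to be compared with the top colour of the block `N` places earlier.
Colours are numbers; colour `0` is reserved for the walls between the rows of a tableau. -/
structure BlockSystem (B : Type) where
  start : B
  next : B → B → Prop
  top : B → Option ℕ
  bot : B → Option ℕ
  final : B → Prop

namespace BlockSystem

variable {B : Type} (S : BlockSystem B)

/-- There is a sequence of blocks from the start block to a final block, and a row length `N`, such
that every bottom colour equals the top colour `N` blocks earlier. -/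
def Solvable : Prop :=
  ∃ (N M : ℕ) (s : ℕ → B), s 0 = S.start ∧ (∀ i < M, S.next (s i) (s (i + 1))) ∧ S.final (s M) ∧
    ∀ i ≤ M, ∀ c, S.bot (s i) = some c → N ≤ i ∧ S.top (s (i - N)) = some c

/-- The blocks without bottom colour form the first row: it starts with a wall and has no other
wall, and the first block after it is again a wall. All colours are less than `k`. -/
structure IsTableau (k : ℕ) : Prop where
  bot_start : S.bot S.start = none
  top_start : S.top S.start = some 0
  top_ne : ∀ β β', S.next β β' → S.bot β' = none → S.top β' ≠ some 0
  bot_next : ∀ β β', S.next β β' → S.bot β = none → S.bot β' ≠ none →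
    S.bot β' = some 0 ∧ ¬ S.final β'
  top_final : ∀ β, S.final β → S.top β = none ∧ S.bot β ≠ none
  top_lt : ∀ β c, S.top β = some c → c < k
  bot_lt : ∀ β c, S.bot β = some c → c < k

/-- The positions in a block that represent the colour `c`. The two adjacent positions of the wall
colour `0` fix the alignment of the rows. -/
def IsPos (c j : ℕ) : Prop := j = 2 * c ∨ (c = 0 ∧ j = 1)

/-- The graph in which each block is a path of `2 * k` nodes, where the marked and the checked nodes
represent the top and the bottom colour in unary. -/
def toGraph (k : ℕ) : CheckGraph (B × ℕ) where
  start := (S.start, 0)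
  edge v w := (w.1 = v.1 ∧ w.2 = v.2 + 1 ∧ v.2 + 1 < 2 * k) ∨
    (v.2 + 1 = 2 * k ∧ w.2 = 0 ∧ S.next v.1 w.1)
  marked v := ∃ c, S.top v.1 = some c ∧ IsPos c v.2
  checked v := ∃ c, S.bot v.1 = some c ∧ IsPos c v.2
  final v := S.final v.1 ∧ ∃ c, S.bot v.1 = some c ∧ v.2 = 2 * c

theorem block_div {K i j : ℕ} (hj : j < K) : (i * K + j) / K = i := by
  rw [mul_comm, Nat.mul_add_div (by omega), Nat.div_eq_of_lt hj, add_zero]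

theorem block_mod {K i j : ℕ} (hj : j < K) : (i * K + j) % K = j := by
  rw [mul_comm, Nat.mul_add_mod, Nat.mod_eq_of_lt hj]

theorem toGraph_solvable {k : ℕ} (hS : S.IsTableau k) (h : S.Solvable) :
    (S.toGraph k).Solvable := by
  obtain ⟨N, M, s, h0, hE, hM, hc⟩ := h
  obtain ⟨c, hcM⟩ := Option.ne_none_iff_exists'.1 (hS.top_final _ hM).2
  have hck := hS.bot_lt _ _ hcM
  have hk : 0 < 2 * k := by omega
  have hdiv : (M * (2 * k) + 2 * c) / (2 * k) = M := block_div (by omega)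
  have hmod : (M * (2 * k) + 2 * c) % (2 * k) = 2 * c := block_mod (by omega)
  refine ⟨N * (2 * k), M * (2 * k) + 2 * c, fun n => (s (n / (2 * k)), n % (2 * k)), ?_, ?_, ?_, ?_⟩
  · simp [toGraph, h0]
  · intro n hn
    have hlt := Nat.mod_lt n hk
    have hd := Nat.div_add_mod' n (2 * k)
    by_cases hj : n % (2 * k) + 1 = 2 * k
    · have e : n + 1 = (n / (2 * k) + 1) * (2 * k) := by rw [add_mul, one_mul]; omega
      have e1 : (n + 1) / (2 * k) = n / (2 * k) + 1 := by rw [e, Nat.mul_div_cancel _ hk]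
      have e2 : (n + 1) % (2 * k) = 0 := by rw [e, Nat.mul_mod_left]
      refine Or.inr ⟨hj, e2, ?_⟩
      simp only [e1]
      refine hE _ ?_
      have : (n + 1) / (2 * k) ≤ M := hdiv ▸ Nat.div_le_div_right hn
      omega
    · have hj' : n % (2 * k) + 1 < 2 * k := by omega
      have e : n + 1 = n / (2 * k) * (2 * k) + (n % (2 * k) + 1) := by omega
      have e1 : (n + 1) / (2 * k) = n / (2 * k) := (congrArg (· / (2 * k)) e).trans (block_div hj')
      have e2 : (n + 1) % (2 * k) = n % (2 * k) + 1 :=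
        (congrArg (· % (2 * k)) e).trans (block_mod hj')
      exact Or.inl ⟨by simp only [e1], e2, by simp only; omega⟩
  · exact ⟨by simpa only [hdiv] using hM, c, by simpa only [hdiv] using hcM, hmod⟩
  · rintro n hn ⟨c', hc', hpos⟩
    have hnM : n / (2 * k) ≤ M := hdiv ▸ Nat.div_le_div_right hn
    obtain ⟨h1, h2⟩ := hc _ hnM c' hc'
    have h3 : N * (2 * k) ≤ n := (Nat.le_div_iff_mul_le hk).1 h1
    refine ⟨h3, c', ?_, ?_⟩
    · simpa only [Nat.sub_mul_div_of_le, mul_comm N, Nat.sub_mul_div] using h2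
    · simp only
      rw [mul_comm N, Nat.sub_mul_mod (by rwa [mul_comm])]
      exact hpos

/-- The first checked nodes, at the two adjacent positions of the first wall below the start row,
force the shift to be a multiple of the block length. -/
theorem solvable_of_toGraph {k : ℕ} (hk : 2 ≤ k) (hS : S.IsTableau k)
    (h : (S.toGraph k).Solvable) : S.Solvable := by
  obtain ⟨d, m, x, h0, hE, hm, hc⟩ := h
  have hK : 0 < 2 * k := by omega
  have hx : ∀ n ≤ m, (x n).2 = n % (2 * k) ∧ (x n).1 = (x (n / (2 * k) * (2 * k))).1 := by
    intro n
    induction n with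
    | zero => simp [h0, toGraph]
    | succ n ih =>
      intro hn
      obtain ⟨i1, i2⟩ := ih (by omega)
      have hd := Nat.div_add_mod' n (2 * k)
      rcases hE n hn with ⟨a1, a2, a3⟩ | ⟨a1, a2, a3⟩
      · rw [i1] at a2 a3
        have hj' : n % (2 * k) + 1 < 2 * k := by omega
        have e : n + 1 = n / (2 * k) * (2 * k) + (n % (2 * k) + 1) := by omega
        have e1 : (n + 1) / (2 * k) = n / (2 * k) :=
          (congrArg (· / (2 * k)) e).trans (block_div hj')
        have e2 : (n + 1) % (2 * k) = n % (2 * k) + 1 :=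
          (congrArg (· % (2 * k)) e).trans (block_mod hj')
        rw [e1, e2, a1, i2]
        exact ⟨a2, rfl⟩
      · rw [i1] at a1
        have e : n + 1 = (n / (2 * k) + 1) * (2 * k) := by rw [add_mul, one_mul]; omega
        have e1 : (n + 1) / (2 * k) = n / (2 * k) + 1 := by rw [e, Nat.mul_div_cancel _ hK]
        have e2 : (n + 1) % (2 * k) = 0 := by rw [e, Nat.mul_mod_left]
        rw [e1, e2, ← e]
        exact ⟨a2, rfl⟩
  set s : ℕ → B := fun i => (x (i * (2 * k))).1 with hs
  have hxs : ∀ i j, j < 2 * k → i * (2 * k) + j ≤ m → x (i * (2 * k) + j) = (s i, j) := by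
    intro i j hj hij
    obtain ⟨h1, h2⟩ := hx _ hij
    rw [block_div hj] at h2
    rw [block_mod hj] at h1
    exact Prod.ext h2 h1
  have hmM : m = m / (2 * k) * (2 * k) + m % (2 * k) := (Nat.div_add_mod' m (2 * k)).symm
  set M := m / (2 * k) with hM
  have hmod := Nat.mod_lt m hK
  have hle : ∀ i ≤ M, i * (2 * k) ≤ m := fun i hi =>
    (Nat.mul_le_mul_right _ hi).trans (Nat.div_mul_le_self ..)
  have hsucc : ∀ i < M, i * (2 * k) + 2 * k ≤ m := fun i hi => by
    have := hle (i + 1) hi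
    rwa [add_mul, one_mul] at this
  have hs0 : s 0 = S.start := by simp [hs, h0, toGraph]
  have hnext : ∀ i < M, S.next (s i) (s (i + 1)) := by
    intro i hi
    have h1 := hsucc i hi
    have h2 := hE (i * (2 * k) + (2 * k - 1)) (by omega)
    rw [hxs i _ (by omega) (by omega),
      show i * (2 * k) + (2 * k - 1) + 1 = (i + 1) * (2 * k) + 0 by rw [add_mul]; omega,
      hxs (i + 1) 0 hK (hle _ hi)] at h2
    rcases h2 with ⟨-, h2, -⟩ | ⟨-, -, h2⟩
    · exact absurd h2 (by simp)
    · exact h2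
  have hxm : x m = (s M, m % (2 * k)) := by
    conv_lhs => rw [hmM]
    exact hxs M _ hmod (by omega)
  obtain ⟨hfin, c, hcM, hcj⟩ : S.final (s M) ∧ ∃ c, S.bot (s M) = some c ∧ m % (2 * k) = 2 * c := by
    rw [hxm] at hm
    exact hm
  have hex : ∃ i, S.bot (s i) ≠ none := ⟨M, by simp [hcM]⟩
  classical
  obtain ⟨N, hN, hmin⟩ : ∃ N, S.bot (s N) ≠ none ∧ ∀ i < N, S.bot (s i) = none :=
    ⟨Nat.find hex, Nat.find_spec hex, fun i hi => not_not.1 (Nat.find_min hex hi)⟩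
  have hNM : N ≤ M := by
    by_contra hcon
    simpa [hcM] using hmin M (by omega)
  have hN0 : N ≠ 0 := by
    rintro rfl
    exact hN (hs0 ▸ hS.bot_start)
  obtain ⟨N', rfl⟩ := Nat.exists_eq_succ_of_ne_zero hN0
  obtain ⟨hwall, hnf⟩ := hS.bot_next _ _ (hnext N' (by omega)) (hmin N' (by omega)) hN
  have hlt : N' + 1 < M := lt_of_le_of_ne hNM (by rintro h; exact hnf (h ▸ hfin))
  have htop : ∀ i ≤ N', S.top (s i) = some 0 → i = 0 := by
    rintro (_ | i) hi h
    · rfl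
    · exact absurd h (hS.top_ne _ _ (hnext i (by omega)) (hmin _ (by omega)))
  have hbound := hsucc _ hlt
  -- The nodes `d` steps before the two checked positions of the wall are adjacent and marked.
  have hm0 := hc ((N' + 1) * (2 * k) + 0) (by omega)
    (by rw [hxs _ 0 hK (by omega)]; exact ⟨0, hwall, Or.inl rfl⟩)
  have hm1 := hc ((N' + 1) * (2 * k) + 1) (by omega)
    (by rw [hxs _ 1 (by omega) (by omega)]; exact ⟨0, hwall, Or.inr ⟨rfl, rfl⟩⟩)
  have hd0 : d ≠ 0 := by
    rintro rfl
    obtain ⟨c', h1, -⟩ := (hc m le_rfl (by rw [hxm]; exact ⟨c, hcM, Or.inl hcj⟩)).2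
    rw [Nat.sub_zero, hxm, (hS.top_final _ hfin).1] at h1
    simp at h1
  have hsplit : ∀ n ≤ m, (S.toGraph k).marked (x n) →
      ∃ i j, n = i * (2 * k) + j ∧ j < 2 * k ∧ (j % 2 = 0 ∨ (j = 1 ∧ S.top (s i) = some 0)) ∧
        (S.top (s i) = some 0 → j ≤ 1) := by
    intro n hn hmk
    have hn' : n = n / (2 * k) * (2 * k) + n % (2 * k) := (Nat.div_add_mod' n (2 * k)).symm
    refine ⟨n / (2 * k), n % (2 * k), hn', Nat.mod_lt _ hK, ?_⟩
    rw [hn', hxs _ _ (Nat.mod_lt _ hK) (by omega)] at hmk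
    obtain ⟨c', h1, h2⟩ := hmk
    simp only at h1 h2
    refine ⟨?_, fun h => ?_⟩
    · rcases h2 with h2 | ⟨rfl, h2⟩
      exacts [Or.inl (by omega), Or.inr ⟨h2, h1⟩]
    · rw [h] at h1
      obtain rfl : 0 = c' := by simpa using h1
      rcases h2 with h2 | ⟨-, h2⟩ <;> omega
  have hdN : d = (N' + 1) * (2 * k) := by
    obtain ⟨i, j, e, hj, hpos, hpos'⟩ := hsplit _ (by omega) hm0.2
    obtain ⟨i', j', e', hj', hq, hq'⟩ := hsplit _ (by omega) hm1.2
    have hi : i * (2 * k) + j < (N' + 1) * (2 * k) := by omega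
    have hiN : i ≤ N' := by
      by_contra hcon
      have := Nat.mul_le_mul_right (2 * k) (show N' + 1 ≤ i by omega)
      omega
    have hee : i' * (2 * k) + j' = i * (2 * k) + j + 1 := by omega
    by_cases hjl : j + 1 = 2 * k
    · rcases hpos with h1 | ⟨h1, -⟩ <;> omega
    · have hii : i' = i := by
        have e2 : (i * (2 * k) + (j + 1)) / (2 * k) = i := block_div (by omega)
        rw [← block_div (i := i') hj', hee, add_assoc, e2]
      subst hii
      have hjj : j' = j + 1 := by omega
      have htop0 : S.top (s i') = some 0 := by
        rcases hpos with h1 | ⟨-, h1⟩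
        · rcases hq with h2 | ⟨-, h1⟩
          · omega
          · exact h1
        · exact h1
      have := htop i' hiN htop0
      have := hq' htop0
      subst i'
      omega
  subst hdN
  refine ⟨N' + 1, M, s, hs0, hnext, hfin, fun i hi c' hc' => ?_⟩
  have hc'k := hS.bot_lt _ _ hc'
  have hin : i * (2 * k) + 2 * c' ≤ m := by
    rcases hi.lt_or_eq with h | rfl
    · have := hsucc i h
      omega
    · rw [hcM] at hc'
      obtain rfl : c = c' := by simpa using hc'
      omega
  obtain ⟨h1, h2⟩ := hc (i * (2 * k) + 2 * c') hin
    (by rw [hxs _ _ (by omega) hin]; exact ⟨c', hc', Or.inl rfl⟩)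
  have hNi : N' + 1 ≤ i := by
    by_contra hcon
    have := Nat.mul_le_mul_right (2 * k) (show i + 1 ≤ N' + 1 by omega)
    rw [add_mul i] at this
    omega
  refine ⟨hNi, ?_⟩
  have hmul := Nat.mul_le_mul_right (2 * k) hNi
  rw [show i * (2 * k) + 2 * c' - (N' + 1) * (2 * k) = (i - (N' + 1)) * (2 * k) + 2 * c' by
    rw [Nat.sub_mul]; omega, hxs _ _ (by omega) (by rw [Nat.sub_mul]; omega)] at h2
  obtain ⟨c'', h3, h4⟩ := h2
  simp only at h3 h4
  rcases h4 with h4 | ⟨-, h4⟩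
  · rw [h3]
    congr 1
    omega
  · omega

end BlockSystem
end DL

/-! ### Tableaux of one-dimensional cellular automata -/

namespace DL

/-- A one-dimensional cellular automaton with cells from `D` that is run between two walls; a wall
is represented by `none`. The input, a word of length `len`, is surrounded by blank cells. -/
structure Automaton (D : Type) where
  rule : Option D → Option D → Option D → Option D
  rule_wall : ∀ x z, rule x none z = none
  halting : D → Prop
  blank : D

namespace Automaton

variable {D : Type} (A : Automaton D)

/-- The initial cells: the first `len` letters of `w` at the positions from `0` on, and blanks. -/
def init (len : ℕ) (w : ℕ → D) (i : ℤ) : D := if 0 ≤ i ∧ i < len then w i.toNat else A.blank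

/-- The cells at time `t` when there are walls at all positions outside the interval `[-L, R)`. -/
def row (len : ℕ) (w : ℕ → D) (L R : ℕ) : ℕ → ℤ → Option D
  | 0, i => if -(L : ℤ) ≤ i ∧ i < R then some (A.init len w i) else none
  | t + 1, i => A.rule (row len w L R t (i - 1)) (row len w L R t i) (row len w L R t (i + 1))

/-- The blocks of the tableau: the wall, blanks to the left of the input, input letters and blanks
to the right of the input, which make up the first row, and overlapping triples of cells. -/
inductive Block (D : Type) : Type
  | start
  | left
  | input (i : ℕ)
  | right
  | main (x y z : Option D)

/-- The possible successors of a block. -/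
inductive Next (len : ℕ) : Block D → Block D → Prop
  | start_left : Next len .start .left
  | left_left : Next len .left .left
  | left_input : Next len .left (.input 0)
  | input_input (i : ℕ) : i + 1 < len → Next len (.input i) (.input (i + 1))
  | input_right (i : ℕ) : i + 1 = len → Next len (.input i) .right
  | right_right : Next len .right .right
  | right_main (x z : Option D) : Next len .right (.main x none z)
  | main_main (x y z u : Option D) : Next len (.main x y z) (.main y z u)

open Classical in
/-- The tableau of an automaton. The bottom colour of a triple is its middle cell, the top colour
is the next state of that cell. The numbering `col` of the colours maps the wall to `0`. -/
noncomputable def tableau (col : Option D → ℕ) (len : ℕ) (w : ℕ → D) : BlockSystem (Block D) where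
  start := .start
  next := Next len
  top
    | .start => some 0
    | .left => some (col (some A.blank))
    | .input i => some (col (some (w i)))
    | .right => some (col (some A.blank))
    | .main x y z => if ∃ d, y = some d ∧ A.halting d then none else some (col (A.rule x y z))
  bot
    | .main _ y _ => some (col y)
    | _ => none
  final
    | .main _ y _ => ∃ d, y = some d ∧ A.halting d
    | _ => False

variable {A} {col : Option D → ℕ} {len : ℕ} {w : ℕ → D}

theorem isTableau (hcol : Function.Injective col) (h0 : col none = 0) {k : ℕ}
    (hk : ∀ x, col x < k) : (A.tableau col len w).IsTableau k where
  bot_start := rfl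
  top_start := rfl
  top_ne := by
    have hne : ∀ d, col (some d) ≠ 0 := fun d h => by simpa using hcol (h.trans h0.symm)
    rintro β β' (_ | _) hb <;> simp_all [tableau]
  bot_next := by
    rintro β β' (_ | _) hb hb' <;> simp_all [tableau]
  top_final := by
    rintro (_ | _ | _ | _ | _) h
    all_goals first | exact h.elim | exact ⟨if_pos h, by simp [tableau]⟩
  top_lt := by
    rintro (_ | _ | _ | _ | ⟨x, y, z⟩) c hc <;> simp only [tableau] at hc
    all_goals try split_ifs at hc
    all_goals
      obtain rfl := Option.some_injective _ hc
      first | exact hk _ | exact h0 ▸ hk none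
  bot_lt := by
    rintro (_ | _ | _ | _ | ⟨x, y, z⟩) c hc
    all_goals first | exact Option.some_injective _ hc ▸ hk _ | exact absurd hc (by simp [tableau])

theorem row_eq_none {L R : ℕ} {i : ℤ} (hi : i < -L ∨ R ≤ i) (t : ℕ) :
    A.row len w L R t i = none := by
  induction t with
  | zero => exact if_neg (by omega)
  | succ t ih => rw [row, ih, A.rule_wall]

variable (A len w) in
/-- The rows written one after the other, each preceded by a wall. -/
def grid (L R n : ℕ) : Option D :=
  A.row len w L R (n / (L + R + 1)) ((n % (L + R + 1) : ℕ) - (L + 1 : ℤ))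

theorem grid_mul_add {L R t c : ℕ} (hc : c < L + R + 1) :
    A.grid len w L R (t * (L + R + 1) + c) = A.row len w L R t (c - (L + 1 : ℤ)) := by
  rw [grid, BlockSystem.block_div hc, BlockSystem.block_mod hc]

theorem grid_add {L R : ℕ} (n : ℕ) :
    A.grid len w L R (n + (L + R + 1)) =
      A.rule (A.grid len w L R (n - 1)) (A.grid len w L R n) (A.grid len w L R (n + 1)) := by
  obtain ⟨t, c, hc, rfl⟩ : ∃ t c, c < L + R + 1 ∧ n = t * (L + R + 1) + c :=
    ⟨_, _, Nat.mod_lt n (Nat.succ_pos _), (Nat.div_add_mod' n _).symm⟩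
  have e1 : t * (L + R + 1) + c + (L + R + 1) = (t + 1) * (L + R + 1) + c := by ring
  rw [e1, grid_mul_add hc, grid_mul_add hc, row]
  rcases Nat.eq_zero_or_pos c with rfl | hpos
  · rw [row_eq_none (i := ((0 : ℕ) : ℤ) - (L + 1)) (by omega), A.rule_wall, A.rule_wall]
  · rw [show t * (L + R + 1) + c - 1 = t * (L + R + 1) + (c - 1) by omega,
      grid_mul_add (by omega), show ((c - 1 : ℕ) : ℤ) - (L + 1) = c - (L + 1 : ℤ) - 1 by omega]
    congr 1
    rcases Nat.lt_or_ge (c + 1) (L + R + 1) with h | h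
    · rw [add_assoc, grid_mul_add h]
      congr 1
      omega
    · rw [show t * (L + R + 1) + c + 1 = (t + 1) * (L + R + 1) + 0 by rw [add_mul]; omega,
        grid_mul_add (by omega), row_eq_none (by omega), row_eq_none (by omega)]

theorem grid_of_lt {L R n : ℕ} (hn : n < L + R + 1) :
    A.grid len w L R n = A.row len w L R 0 (n - (L + 1 : ℤ)) := by
  have := grid_mul_add (A := A) (len := len) (w := w) (t := 0) hn
  rwa [zero_mul, zero_add] at this

theorem grid_zero {L R : ℕ} : A.grid len w L R 0 = none := by
  rw [grid_of_lt (by omega), row_eq_none (by omega)]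

/-- The blocks of the first row with `L` blanks to the left of the input. -/
def firstRow (len L n : ℕ) : Block D :=
  if n = 0 then .start else if n ≤ L then .left else if n ≤ L + len then .input (n - (L + 1))
    else .right

theorem top_firstRow (h0 : col none = 0) {L R n : ℕ} (hn : n < L + R + 1) :
    (A.tableau col len w).top (firstRow len L n) = some (col (A.grid len w L R n)) := by
  rw [grid_of_lt hn, firstRow, row]
  split_ifs with h1 h2 h3 h4 h5 h6
  all_goals try omega
  · simp [tableau, h0]
  · simp only [tableau, init]
    rw [if_neg (by omega)]
  · simp only [tableau, init]
    rw [if_pos (by omega)]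
    congr 4
    omega
  · simp only [tableau, init]
    rw [if_neg (by omega)]

theorem next_firstRow {L n : ℕ} (hlen : 0 < len) (hL : 0 < L) :
    Next (D := D) len (firstRow len L n) (firstRow len L (n + 1)) := by
  unfold firstRow
  split_ifs
  all_goals first | omega | contradiction | skip
  · exact .start_left
  · exact .left_left
  · rw [show n + 1 - (L + 1) = 0 by omega]
    exact .left_input
  · rw [show n + 1 - (L + 1) = n - (L + 1) + 1 by omega]
    exact .input_input _ (by omega)
  · exact .input_right _ (by omega)
  · exact .right_right

/-- A run that meets a halting cell gives a solution: the blocks of the first row, followed by the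
triples of adjacent cells in the grid up to the first halting cell. -/
theorem tableau_solvable (h0 : col none = 0) (hlen : 0 < len) {L R t : ℕ} {i : ℤ} {d : D}
    (hL : 0 < L) (hR : len < R) (hd : A.row len w L R t i = some d) (hh : A.halting d) :
    (A.tableau col len w).Solvable := by
  classical
  have hi : -(L : ℤ) ≤ i ∧ i < R := by
    by_contra hcon
    rw [row_eq_none (by omega)] at hd
    simp at hd
  set g := A.grid len w L R with hg
  have hex : ∃ n, ∃ d, g n = some d ∧ A.halting d := by
    refine ⟨t * (L + R + 1) + (i + (L + 1)).toNat, d, ?_, hh⟩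
    rw [hg, grid_mul_add (by omega), ← hd]
    congr 1
    omega
  obtain ⟨n₀, hn₀, hmin⟩ : ∃ n, (∃ d, g n = some d ∧ A.halting d) ∧
      ∀ j < n, ¬ ∃ d, g j = some d ∧ A.halting d :=
    ⟨Nat.find hex, Nat.find_spec hex, fun j hj => Nat.find_min hex hj⟩
  set N := L + R + 1 with hN
  let s : ℕ → Block D := fun n =>
    if n < N then firstRow len L n else .main (g (n - N - 1)) (g (n - N)) (g (n - N + 1))
  have hs : ∀ n, s (n + N) = .main (g (n - 1)) (g n) (g (n + 1)) := fun n => by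
    simp [s]
  have hs' : ∀ n < N, s n = firstRow len L n := fun n hn => if_pos hn
  have htop : ∀ j ≤ n₀, (A.tableau col len w).top (s j) = some (col (g j)) := by
    intro j hj
    rcases Nat.lt_or_ge j N with h | h
    · rw [hs' j h, top_firstRow h0 h]
    · obtain ⟨j', rfl⟩ := Nat.exists_eq_add_of_le' h
      rw [hs, hg, hN, grid_add, ← hg]
      exact if_neg (hmin j' (by omega))
  refine ⟨N, n₀ + N, s, ?_, fun n hn => ?_, ?_, fun j hj c hc => ?_⟩
  · rw [hs' 0 (by omega)]
    rfl
  · rcases Nat.lt_or_ge n N with h | h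
    · rcases Nat.lt_or_ge (n + 1) N with h' | h'
      · rw [hs' n h, hs' _ h']
        exact next_firstRow hlen hL
      · have hnN : n + 1 = N := by omega
        have := hs 0
        rw [zero_add, hg, grid_zero] at this
        rw [hs' n h, hnN, this, firstRow, if_neg (by omega), if_neg (by omega), if_neg (by omega)]
        exact .right_main _ _
    · obtain ⟨j, rfl⟩ := Nat.exists_eq_add_of_le' h
      rw [hs, show j + N + 1 = (j + 1) + N by omega, hs]
      exact .main_main _ _ _ _
  · rw [hs]
    exact hn₀
  · rcases Nat.lt_or_ge j N with h | h
    · rw [hs' j h, firstRow] at hc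
      split_ifs at hc <;> simp [tableau] at hc
    · obtain ⟨j', rfl⟩ := Nat.exists_eq_add_of_le' h
      rw [hs] at hc
      rw [Nat.add_sub_cancel]
      exact ⟨h, (htop j' (by omega)).trans hc⟩

/-- A sequence of blocks without triples is part of a first row. -/
theorem exists_firstRow (hlen : 0 < len) {s : ℕ → Block D} (h0 : s 0 = .start) {n : ℕ}
    (hE : ∀ i < n, Next len (s i) (s (i + 1))) (hmain : ∀ i ≤ n, ∀ x y z, s i ≠ .main x y z) :
    ∃ L ≤ n, (L = 0 → n = 0) ∧ ∀ i ≤ n, s i = firstRow len L i := by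
  induction n with
  | zero => exact ⟨0, le_rfl, fun _ => rfl, fun i hi => by obtain rfl : i = 0 := by omega
                                                           simpa [firstRow] using h0⟩
  | succ n ih =>
    obtain ⟨L, hL, hL0, hs⟩ := ih (fun i hi => hE i (by omega)) (fun i hi => hmain i (by omega))
    -- Either one more blank precedes the input, or the first row goes on as it has to.
    suffices (L = n ∧ s (n + 1) = .left) ∨ (0 < L ∧ s (n + 1) = firstRow len L (n + 1)) by
      rcases this with ⟨rfl, h⟩ | ⟨hpos, h⟩
      · refine ⟨L + 1, le_rfl, by omega, fun i hi => ?_⟩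
        rcases Nat.lt_or_ge L i with hi' | hi'
        · obtain rfl : i = L + 1 := by omega
          rw [h, firstRow, if_neg (by omega), if_pos le_rfl]
        · rw [hs i hi', firstRow, firstRow]
          by_cases hi0 : i = 0
          · rw [if_pos hi0, if_pos hi0]
          · rw [if_neg hi0, if_neg hi0, if_pos hi', if_pos (by omega)]
      · refine ⟨L, by omega, by omega, fun i hi => ?_⟩
        rcases Nat.lt_or_ge n i with hi' | hi'
        · obtain rfl : i = n + 1 := by omega
          exact h
        · exact hs i hi'
    have hnext := hE n (by omega)
    have hnm := hmain (n + 1) le_rfl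
    rw [hs n le_rfl] at hnext
    unfold firstRow at hnext ⊢
    generalize s (n + 1) = b at hnext hnm
    split_ifs at hnext with h1 h2 h3
    · cases hnext
      exact Or.inl ⟨by omega, rfl⟩
    · obtain rfl : n = L := by omega
      cases hnext with
      | left_left => exact Or.inl ⟨rfl, rfl⟩
      | left_input =>
        refine Or.inr ⟨by omega, ?_⟩
        rw [if_neg (by omega), if_neg (by omega), if_pos (by omega), Nat.sub_self]
    · refine Or.inr ⟨by omega, ?_⟩
      generalize hj : n - (L + 1) = j at hnext
      cases hnext with
      | input_input _ h =>
        rw [if_neg (by omega), if_neg (by omega), if_pos (by omega)]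
        congr 1
        omega
      | input_right _ h => rw [if_neg (by omega), if_neg (by omega), if_neg (by omega)]
    · refine Or.inr ⟨by omega, ?_⟩
      cases hnext with
      | right_right => rw [if_neg (by omega), if_neg (by omega), if_neg (by omega)]
      | right_main => exact (hnm _ _ _ rfl).elim

/-- In a solution the shift is the length of the first row, since the first triple has the wall in
the middle and the only other wall is the start block. By induction the triples then show the rows
of a run. -/
theorem exists_halting_of_tableau (hcol : Function.Injective col) (h0 : col none = 0)
    (hlen : 0 < len) (h : (A.tableau col len w).Solvable) :
    ∃ (L R t : ℕ) (i : ℤ) (d : D), A.row len w L R t i = some d ∧ A.halting d := by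
  classical
  obtain ⟨N, M, s, hs0, hE, hM, hc⟩ := h
  obtain ⟨x, y, z, hsM⟩ : ∃ x y z, s M = .main x y z := by
    generalize s M = b at hM
    cases b
    all_goals first | exact hM.elim | exact ⟨_, _, _, rfl⟩
  rw [hsM] at hM
  have hN : N ≠ 0 := by
    rintro rfl
    have := (hc M le_rfl (col y) (by rw [hsM]; rfl)).2
    rw [Nat.sub_zero, hsM] at this
    exact absurd ((if_pos hM).symm.trans this) (by simp)
  -- The first triple occurs at index `N`.
  have hex : ∃ n, ∃ x y z, s n = .main x y z := ⟨M, x, y, z, hsM⟩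
  obtain ⟨n₁, ⟨x₁, y₁, z₁, h₁⟩, hmin⟩ : ∃ n, (∃ x y z, s n = .main x y z) ∧
      ∀ j < n, ¬ ∃ x y z, s j = .main x y z :=
    ⟨Nat.find hex, Nat.find_spec hex, fun j hj => Nat.find_min hex hj⟩
  have hn₁M : n₁ ≤ M := by
    by_contra hcon
    exact hmin M (by omega) ⟨x, y, z, hsM⟩
  have hn₁ : n₁ ≠ 0 := by
    rintro rfl
    rw [hs0] at h₁
    simp [tableau] at h₁
  obtain ⟨L, hL, hL0, hfirst⟩ := exists_firstRow (n := n₁ - 1) hlen hs0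
    (fun i hi => hE i (by omega)) (fun i hi x y z h => hmin i (by omega) ⟨x, y, z, h⟩)
  have hlast : L + len < n₁ - 1 ∧ 0 < L ∧ y₁ = none := by
    have hnext := hE (n₁ - 1) (by omega)
    rw [Nat.sub_add_cancel (by omega), h₁, hfirst _ le_rfl, firstRow] at hnext
    split_ifs at hnext with h1 h2 h3
    · cases hnext
    · cases hnext
    · generalize n₁ - 1 - (L + 1) = j at hnext
      cases hnext
    · cases hnext
      exact ⟨by omega, by omega, rfl⟩
  obtain ⟨hlast, hLpos, rfl⟩ := hlast
  obtain ⟨R, hR⟩ : ∃ R, n₁ = L + R + 1 := ⟨n₁ - 1 - L, by omega⟩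
  have hn₁N : n₁ = N := by
    obtain ⟨h2, h3⟩ := hc n₁ hn₁M (col none) (by rw [h₁]; rfl)
    rw [hfirst _ (by omega), top_firstRow (R := R) h0 (by omega)] at h3
    have h4 := hcol (Option.some_injective _ h3)
    by_contra hcon
    rw [grid_of_lt (by omega), row, if_pos (by omega)] at h4
    simp at h4
  subst hn₁N
  have hmain : ∀ n, n + n₁ ≤ M → ∃ x y z, s (n + n₁) = .main x y z := by
    intro n
    induction n with
    | zero => exact fun _ => ⟨_, _, _, by rw [zero_add]; exact h₁⟩
    | succ n ih =>
      intro hn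
      obtain ⟨x, y, z, hxyz⟩ := ih (by omega)
      have hnext := hE (n + n₁) (by omega)
      rw [hxyz] at hnext
      rw [show n + 1 + n₁ = n + n₁ + 1 by omega]
      generalize s (n + n₁ + 1) = b at hnext
      cases hnext
      exact ⟨_, _, _, rfl⟩
  have key : ∀ n, n + n₁ ≤ M → ∀ x y z, s (n + n₁) = .main x y z → y = A.grid len w L R n := by
    intro n
    induction n using Nat.strong_induction_on with
    | _ n ih =>
      intro hn x y z hxyz
      have htop := (hc (n + n₁) hn (col y) (by rw [hxyz]; rfl)).2
      rw [Nat.add_sub_cancel] at htop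
      rcases Nat.lt_or_ge n n₁ with h | h
      · rw [hfirst n (by omega), top_firstRow (R := R) h0 (by omega)] at htop
        exact (hcol (Option.some_injective _ htop)).symm
      · obtain ⟨j, rfl⟩ := Nat.exists_eq_add_of_le' h
        obtain ⟨x', y', z', hj⟩ := hmain j (by omega)
        obtain ⟨x'', y'', z'', hj'⟩ := hmain (j + 1) (by omega)
        have hy' := ih j (by omega) (by omega) _ _ _ hj
        have hy'' := ih (j + 1) (by omega) (by omega) _ _ _ hj'
        have hz : z' = y'' := by
          have hnext := hE (j + n₁) (by omega)
          rw [hj, show j + n₁ + 1 = j + 1 + n₁ by omega, hj'] at hnext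
          cases hnext
          rfl
        have htop' : some (col (A.rule x' y' z')) = some (col y) := by
          rw [hj] at htop
          simp only [tableau] at htop
          split_ifs at htop
          exact htop
        rw [← hcol (Option.some_injective _ htop'), hR, grid_add, hz, hy'', hy']
        rcases j with _ | j
        · rw [grid_zero, A.rule_wall, A.rule_wall]
        · obtain ⟨x₂, y₂, z₂, h₂⟩ := hmain j (by omega)
          have hnext := hE (j + n₁) (by omega)
          rw [h₂, show j + n₁ + 1 = j + 1 + n₁ by omega, hj] at hnext
          have hx : x' = y₂ := by
            cases hnext
            rfl
          rw [hx, ih j (by omega) (by omega) _ _ _ h₂, Nat.add_sub_cancel]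
  obtain ⟨d, hy, hd⟩ := hM
  have hNM := (hc M le_rfl (col y) (by rw [hsM]; rfl)).1
  have hgrid := key (M - n₁) (by omega) x y z (by rw [Nat.sub_add_cancel hNM]; exact hsM)
  exact ⟨L, R, _, _, d, hgrid.symm.trans hy, hd⟩

end Automaton
end DL

/-! ### Turing machines as cellular automata -/

namespace DL

open Turing

namespace Machine

variable {Γ Λ : Type} [Inhabited Γ] [Inhabited Λ] (M : TM0.Machine Γ Λ)

/-- The state in which the head leaves the given cell in the direction `d`, if it does so. A cell
consists of a tape symbol and, where the head is, the state of the machine. -/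
def leaving (d : Dir) : Option (Γ × Option Λ) → Option Λ
  | some (γ, some q) =>
    match M q γ with
    | some (q', .move d') => if d' = d then some q' else none
    | _ => none
  | _ => none

/-- The cellular automaton simulating a Turing machine. A cell under the head is halting if the
machine has no next step there. -/
def automaton : Automaton (Γ × Option Λ) where
  rule x y z :=
    match y with
    | none => none
    | some (γ, some q) =>
      match M q γ with
      | some (q', .write γ') => some (γ', some q')
      | some (_, .move _) => some (γ, none)
      | none => some (γ, some q)
    | some (γ, none) => some (γ, leaving M .right x <|> leaving M .left z)
  rule_wall _ _ := rfl
  halting d := ∃ q, d.2 = some q ∧ M q d.1 = none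
  blank := (default, none)

/-- The cell at position `i` in the configuration `c` with the head at position `p`. -/
def cell (c : TM0.Cfg Γ Λ) (p i : ℤ) : Γ × Option Λ :=
  (c.Tape.nth (i - p), if i = p then some c.q else none)

variable {M}

open Classical in
theorem leaving_cell {q q' : Λ} {T : Tape Γ} {a : TM0.Stmt Γ} (h : M q T.head = some (q', a))
    (d : Dir) (p i : ℤ) :
    leaving M d (some (cell ⟨q, T⟩ p i)) = if i = p ∧ a = .move d then some q' else none := by
  unfold cell
  by_cases hi : i = p
  · subst hi
    have h' : M q (T.nth 0) = some (q', a) := h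
    simp only [leaving, sub_self, if_true, h']
    cases a with
    | move d' => by_cases hd : d' = d <;> simp [hd]
    | write a => simp
  · simp [leaving, hi]

/-- One step of the machine is one step of the automaton. The neighbours only matter in so far as
the head comes from there. -/
theorem rule_cell {c c' : TM0.Cfg Γ Λ} (h : c' ∈ TM0.step M c) (p : ℤ) :
    ∃ p', p - 1 ≤ p' ∧ p' ≤ p + 1 ∧ ∀ i x z,
      leaving M .right x = leaving M .right (some (cell c p (i - 1))) →
      leaving M .left z = leaving M .left (some (cell c p (i + 1))) →
      (automaton M).rule x (some (cell c p i)) z = some (cell c' p' i) := by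
  obtain ⟨q, T⟩ := c
  obtain ⟨⟨q', a⟩, hM, rfl⟩ := Option.map_eq_some_iff.1 h
  cases a with
  | write γ =>
    refine ⟨p, by omega, by omega, fun i x z hx hz => ?_⟩
    rw [leaving_cell hM] at hx hz
    by_cases hi : i = p
    · subst hi
      simp [automaton, cell, hM, show (T.write γ).head = γ from rfl]
    · have hi' : i - p ≠ 0 := by omega
      simp [automaton, cell, hi, hi', hx, hz, Tape.write_nth]
  | move d =>
    cases d with
    | left =>
      refine ⟨p - 1, by omega, by omega, fun i x z hx hz => ?_⟩
      rw [leaving_cell hM] at hx hz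
      by_cases hi : i = p
      · subst hi
        have h1 : i ≠ i - 1 := by omega
        simp [automaton, cell, hM, h1]
      · have h1 : i - (p - 1) - 1 = i - p := by omega
        by_cases hi1 : i = p - 1
        · have hi2 : i + 1 = p := by omega
          have h2 : (T.move .left).head = T.nth (-1) := Tape.move_left_nth T 0
          simp [automaton, cell, hi1, hx, hz, h2]
        · have hi2 : i + 1 ≠ p := by omega
          simp [automaton, cell, hi, hi1, hi2, hx, hz, h1]
    | right =>
      refine ⟨p + 1, by omega, by omega, fun i x z hx hz => ?_⟩
      rw [leaving_cell hM] at hx hz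
      by_cases hi : i = p
      · subst hi
        simp [automaton, cell, hM]
      · have h1 : i - (p + 1) + 1 = i - p := by omega
        by_cases hi1 : i = p + 1
        · have h2 : (T.move .right).head = T.nth 1 := Tape.move_right_nth T 0
          simp [automaton, cell, hi1, hx, hz, h2]
        · have hi2 : i - 1 ≠ p := by omega
          simp [automaton, cell, hi, hi1, hi2, hx, hz, h1]

/-- The input word of the automaton: the symbols of `l`, with the head on the first one. -/
def word (l : List Γ) (n : ℕ) : Γ × Option Λ :=
  (l.getI n, if n = 0 then some default else none)

theorem init_eq_cell {l : List Γ} (hl : l ≠ []) (i : ℤ) :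
    (automaton M).init l.length (word l) i = cell (TM0.init l) 0 i := by
  have hpos : 0 < l.length := List.length_pos_iff.2 hl
  unfold Automaton.init cell
  rw [sub_zero]
  rcases i with n | n
  · have hn : (Tape.mk₁ l).nth n = l.getI n := Tape.mk'_nth_nat _ _ _
    by_cases h : n < l.length
    · rw [if_pos ⟨by simp, by simpa using h⟩]
      simp [word, TM0.init, hn]
    · rw [if_neg (by simpa using h)]
      have hn0 : n ≠ 0 := by omega
      simp [automaton, TM0.init, hn, hn0, List.getI_eq_default _ (not_lt.1 h)]
  · rw [if_neg (by simp)]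
    have : (Tape.mk₁ l).nth (Int.negSucc n) = default := by
      simp [Tape.mk₁, Tape.mk₂, Tape.mk', Tape.nth]
    simp [automaton, TM0.init, this]

/-- A reachable configuration is shown by some row if the walls are far enough away. -/
theorem row_eq_cell_of_reaches {l : List Γ} (hl : l ≠ []) {c : TM0.Cfg Γ Λ}
    (h : StateTransition.Reaches (TM0.step M) (TM0.init l) c) :
    ∃ (t : ℕ) (p : ℤ), -t ≤ p ∧ p ≤ t ∧ ∀ (L R : ℕ) (i : ℤ), -(L : ℤ) + t ≤ i → i + t < R →
      (automaton M).row l.length (word l) L R t i = some (cell c p i) := by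
  induction h with
  | refl =>
    refine ⟨0, 0, le_rfl, le_rfl, fun L R i h1 h2 => ?_⟩
    rw [Automaton.row, if_pos (by omega), init_eq_cell hl]
  | tail _ hc ih =>
    obtain ⟨t, p, hp, hp', hrow⟩ := ih
    obtain ⟨p', h1, h2, h3⟩ := rule_cell hc p
    refine ⟨t + 1, p', by omega, by omega, fun L R i hi hi' => ?_⟩
    rw [Automaton.row, hrow L R (i - 1) (by omega) (by omega), hrow L R i (by omega) (by omega),
      hrow L R (i + 1) (by omega) (by omega)]
    exact h3 i _ _ rfl rfl

/-- As long as the machine does not halt, the rows between two walls show its configurations, or no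
head at all once the head has run into a wall. -/
theorem row_of_not_halting {l : List Γ} (hl : l ≠ [])
    (hns : ¬ (StateTransition.eval (TM0.step M) (TM0.init l)).Dom) (L R t : ℕ) :
    (∃ c p, StateTransition.Reaches (TM0.step M) (TM0.init l) c ∧ -(L : ℤ) ≤ p ∧ p < R ∧
      ∀ i : ℤ, -(L : ℤ) ≤ i → i < R →
        (automaton M).row l.length (word l) L R t i = some (cell c p i)) ∨
    ∀ i γ q, (automaton M).row l.length (word l) L R t i ≠ some (γ, some q) := by
  -- A row that shows a configuration is of the first kind if the head is between the walls.
  have key : ∀ (t : ℕ) (c : TM0.Cfg Γ Λ) (p : ℤ),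
      StateTransition.Reaches (TM0.step M) (TM0.init l) c →
      (∀ i : ℤ, -(L : ℤ) ≤ i → i < R →
        (automaton M).row l.length (word l) L R t i = some (cell c p i)) →
      (∃ c p, StateTransition.Reaches (TM0.step M) (TM0.init l) c ∧ -(L : ℤ) ≤ p ∧ p < R ∧
        ∀ i : ℤ, -(L : ℤ) ≤ i → i < R →
          (automaton M).row l.length (word l) L R t i = some (cell c p i)) ∨
      ∀ i γ q, (automaton M).row l.length (word l) L R t i ≠ some (γ, some q) := by
    intro t c p hc hrow
    by_cases hp : -(L : ℤ) ≤ p ∧ p < R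
    · exact Or.inl ⟨c, p, hc, hp.1, hp.2, hrow⟩
    · refine Or.inr fun i γ q => ?_
      by_cases hi : -(L : ℤ) ≤ i ∧ i < R
      · have hip : i ≠ p := by rintro rfl; exact hp hi
        rw [hrow i hi.1 hi.2]
        simp [cell, hip]
      · rw [Automaton.row_eq_none (by omega)]
        simp
  induction t with
  | zero =>
    refine key 0 _ 0 .refl fun i h1 h2 => ?_
    rw [Automaton.row, if_pos ⟨h1, h2⟩, init_eq_cell hl]
  | succ t ih =>
    rcases ih with ⟨c, p, hc, hp, hp', hrow⟩ | hno
    · obtain ⟨c', hc'⟩ : ∃ c', TM0.step M c = some c' := by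
        by_contra hcon
        exact hns (Part.dom_iff_mem.2 ⟨c, StateTransition.mem_eval.2
          ⟨hc, by simpa [Option.eq_none_iff_forall_not_mem] using hcon⟩⟩)
      obtain ⟨p', -, -, h3⟩ := rule_cell hc' p
      refine key (t + 1) c' p' (hc.tail hc') fun i h1 h2 => ?_
      obtain ⟨⟨q', a⟩, hM, -⟩ := Option.map_eq_some_iff.1 hc'
      -- The head does not come from a position outside the walls.
      have hleave : ∀ d j, leaving M d ((automaton M).row l.length (word l) L R t j) =
          leaving M d (some (cell c p j)) := by
        intro d j
        by_cases hj : -(L : ℤ) ≤ j ∧ j < R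
        · rw [hrow j hj.1 hj.2]
        · have hjp : j ≠ p := by rintro rfl; exact hj ⟨hp, hp'⟩
          rw [Automaton.row_eq_none (by omega), leaving_cell hM, if_neg fun h => hjp h.1]
          rfl
      rw [Automaton.row, hrow i h1 h2]
      exact h3 i _ _ (hleave ..) (hleave ..)
    · refine Or.inr fun i γ q => ?_
      have hleave : ∀ d j, leaving M d ((automaton M).row l.length (word l) L R t j) = none := by
        intro d j
        rcases hj : (automaton M).row l.length (word l) L R t j with _ | ⟨γ, _ | q⟩
        · rfl
        · rfl
        · exact absurd hj (hno j γ q)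
      rw [Automaton.row]
      rcases hi : (automaton M).row l.length (word l) L R t i with _ | ⟨γ, _ | q⟩
      · simp [automaton]
      · have : (automaton M).rule ((automaton M).row l.length (word l) L R t (i - 1))
            (some (γ, none))
            ((automaton M).row l.length (word l) L R t (i + 1)) = some (γ, none) := by
          show some (γ, leaving M .right _ <|> leaving M .left _) = _
          rw [hleave, hleave]
          rfl
        rw [this]
        simp
      · exact absurd hi (hno i γ q)

/-- The tableau of the automaton is solvable if and only if the Turing machine halts. -/
theorem tableau_solvable_iff {l : List Γ} (hl : l ≠ []) {col : Option (Γ × Option Λ) → ℕ}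
    (hcol : Function.Injective col) (h0 : col none = 0) :
    ((automaton M).tableau col l.length (word l)).Solvable ↔
      (StateTransition.eval (TM0.step M) (TM0.init l)).Dom := by
  have hpos : 0 < l.length := List.length_pos_iff.2 hl
  constructor
  · intro h
    by_contra hns
    obtain ⟨L, R, t, i, ⟨γ, s⟩, hd, q, hs, hM⟩ :=
      Automaton.exists_halting_of_tableau hcol h0 hpos h
    obtain rfl : s = some q := hs
    rcases row_of_not_halting hl hns L R t with ⟨c, p, hc, hp, hp', hrow⟩ | hno
    · have hi : -(L : ℤ) ≤ i ∧ i < R := by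
        by_contra hcon
        rw [Automaton.row_eq_none (by omega)] at hd
        simp at hd
      rw [hrow i hi.1 hi.2] at hd
      have hip : i = p := by
        by_contra hip
        simp [cell, hip] at hd
      subst hip
      obtain ⟨q', T⟩ := c
      simp only [cell, sub_self, if_true, Option.some.injEq, Prod.mk.injEq] at hd
      obtain ⟨h1, rfl⟩ := hd
      refine hns (Part.dom_iff_mem.2 ⟨_, StateTransition.mem_eval.2 ⟨hc, ?_⟩⟩)
      have h2 : M q' T.head = none := by rw [← hM, ← h1]; rfl
      simp [TM0.step, h2]
    · exact hno i γ q hd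
  · intro h
    obtain ⟨c, hc⟩ := Part.dom_iff_mem.1 h
    obtain ⟨hc, hstep⟩ := StateTransition.mem_eval.1 hc
    obtain ⟨t, p, hp, hp', hrow⟩ := row_eq_cell_of_reaches hl hc
    refine Automaton.tableau_solvable h0 hpos (L := 2 * t + 1) (R := 2 * t + l.length + 1)
      (by omega) (by omega) (hrow _ _ p (by omega) (by omega)) ⟨c.q, by simp [cell], ?_⟩
    obtain ⟨q, T⟩ := c
    simpa [TM0.step, cell] using hstep

end Machine
end DL

/-! ### A universal Turing machine with finitely many states -/

namespace DL

open Turing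

namespace Machine

section Restrict

variable {Γ Λ : Type} [Inhabited Γ] [Inhabited Λ]

/-- The restriction of a machine to a set of states that supports it. -/
def restrict (M : TM0.Machine Γ Λ) (S : Set Λ) (hS : TM0.Supports M S) [Inhabited S] :
    TM0.Machine Γ S := fun q γ =>
  (M q γ).pmap (fun r hr => (⟨r.1, hr⟩, r.2)) fun _ hr => hS.2 hr q.2

/-- The restricted machine has the same start state by `hdef`, hence the same runs. -/
theorem eval_restrict_dom (M : TM0.Machine Γ Λ) (S : Set Λ) (hS : TM0.Supports M S) [Inhabited S]
    (hdef : ((default : S) : Λ) = default) (l : List Γ) :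
    (StateTransition.eval (TM0.step (restrict M S hS)) (TM0.init l)).Dom ↔
      (StateTransition.eval (TM0.step M) (TM0.init l)).Dom := by
  have hr : StateTransition.Respects (TM0.step (restrict M S hS)) (TM0.step M)
      (fun c c' => c' = ⟨c.q, c.Tape⟩) := by
    rintro ⟨q, T⟩ _ rfl
    rcases h : M q T.head with _ | ⟨q', a⟩
    · have : restrict M S hS q T.head = none := by simp [restrict, h]
      simp [TM0.step, h, this]
    · have : restrict M S hS q T.head = some (⟨q', hS.2 h q.2⟩, a) := by
        simp [restrict, h]
      simp only [TM0.step, this, Option.map_some]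
      exact ⟨_, rfl, .single (by simp [TM0.step, h])⟩
  refine (StateTransition.tr_eval_dom hr ?_).symm
  simp [TM0.init, hdef]

end Restrict

theorem trNat_two_pow (n : ℕ) :
    PartrecToTM2.trNat (2 ^ n) = List.replicate n .bit0 ++ [.bit1] := by
  obtain ⟨p, hp, hp'⟩ : ∃ p : PosNum, (p : ℕ) = 2 ^ n ∧
      PartrecToTM2.trPosNum p = List.replicate n .bit0 ++ [.bit1] := by
    induction n with
    | zero => exact ⟨.one, rfl, rfl⟩
    | succ n ih =>
      obtain ⟨p, hp, hp'⟩ := ih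
      exact ⟨.bit0 p, by rw [PosNum.cast_bit0, hp, pow_succ, mul_two],
        by rw [PartrecToTM2.trPosNum, hp', List.replicate_succ, List.cons_append]⟩
  have : ((2 ^ n : ℕ) : Num) = Num.pos p := by
    rw [← hp]
    exact Num.of_to_nat (Num.pos p)
  rw [PartrecToTM2.trNat, this, PartrecToTM2.trNum, hp']

theorem primrec_two_pow : Primrec fun n : ℕ => 2 ^ n := by
  refine (Primrec.nat_rec' .id (.const 1)
    (Primrec.nat_mul.comp (.const 2) (Primrec.snd.comp .snd)).to₂).of_eq fun n => ?_
  induction n with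
  | zero => rfl
  | succ n ih =>
    simp only [id] at ih ⊢
    rw [pow_succ', ← ih]

theorem findGreatest_two_pow (n : ℕ) : Nat.findGreatest (fun k => 2 ^ k = 2 ^ n) (2 ^ n) = n := by
  have h := Nat.findGreatest_spec (P := fun k => 2 ^ k = 2 ^ n) (Nat.lt_two_pow_self (n := n)).le
    rfl
  exact Nat.pow_right_injective le_rfl h

/-- Some machine with finitely many symbols and states halts, for every code `e`, on a word
consisting of two fixed symbols and as many copies of a third one as the number of `e` says if and
only if the evaluation of `e` at `0` terminates. The word encodes a power of two. -/
theorem exists_universal : ∃ (Γ Λ : Type) (_ : Finite Γ) (_ : Finite Λ) (_ : Inhabited Γ)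
    (_ : Inhabited Λ) (M : TM0.Machine Γ Λ) (a b c : Γ), ∀ e : Nat.Partrec.Code,
      (StateTransition.eval (TM0.step M)
        (TM0.init (a :: b :: List.replicate (Encodable.encode e) c))).Dom ↔ (e.eval 0).Dom := by
  classical
  -- The numeral of `2 ^ n` is a word of `n` zeros and a final one, which is easy to generate.
  obtain ⟨f, hf, hfe⟩ : ∃ f : ℕ →. ℕ, Nat.Partrec' (n := 1) (fun v => f v.head) ∧
      ∀ e : Nat.Partrec.Code, f (2 ^ Encodable.encode e) = e.eval 0 := by
    let f : ℕ →. ℕ := fun m => Nat.Partrec.Code.eval (Denumerable.ofNat Nat.Partrec.Code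
      (Nat.findGreatest (fun k => 2 ^ k = m) m)) 0
    refine ⟨f, (Nat.Partrec'.part_iff₁ (f := f)).2 ?_, fun e => ?_⟩
    · refine Nat.Partrec.Code.eval_part.comp ((Computable.ofNat _).comp (Primrec.to_comp ?_))
        (.const 0)
      exact Primrec.nat_findGreatest .id (Primrec.eq.comp (primrec_two_pow.comp .snd) .fst)
    · simp only [f, findGreatest_two_pow, Denumerable.ofNat_encode]
  obtain ⟨C, hC⟩ := ToPartrec.Code.exists_code hf
  -- The start state of the machine evaluating `C`; only finitely many states are reachable from it.
  let _ : Inhabited PartrecToTM2.Λ' := ⟨PartrecToTM2.trNormal C .halt⟩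
  let M1 := TM2to1.tr PartrecToTM2.tr
  have hS := TM1to0.tr_supports M1 (TM2to1.tr_supports _ (PartrecToTM2.tr_supports C .halt))
  let _ : Inhabited (TM1to0.trStmts M1 _) := ⟨⟨default, hS.1⟩⟩
  let cell (s : PartrecToTM2.Γ') : TM2to1.Γ' PartrecToTM2.K' fun _ => PartrecToTM2.Γ' :=
    (false, Function.update (fun _ => none) .main (some s))
  let first : TM2to1.Γ' PartrecToTM2.K' fun _ => PartrecToTM2.Γ' := (true, (cell .cons).2)
  refine ⟨TM2to1.Γ' PartrecToTM2.K' fun _ => PartrecToTM2.Γ', _, ?_, ?_, inferInstance,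
    inferInstance, restrict (TM1to0.tr M1) _ hS, first, cell .bit1, cell .bit0, fun e => ?_⟩
  · have : Finite PartrecToTM2.K' := .of_injective
      (fun k => match k with
        | .main => (0 : Fin 4)
        | .rev => 1
        | .aux => 2
        | .stack => 3) (by rintro (_ | _) (_ | _) h <;> first | rfl | simp at h)
    exact inferInstanceAs (Finite (Bool × (PartrecToTM2.K' → Option PartrecToTM2.Γ')))
  · exact Finset.finite_toSet _
  have hword : first :: cell .bit1 :: List.replicate (Encodable.encode e) (cell .bit0) =
      TM2to1.trInit .main (PartrecToTM2.trList [2 ^ Encodable.encode e]) := by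
    simp only [TM2to1.trInit, PartrecToTM2.trList, trNat_two_pow, List.reverse_append,
      List.reverse_cons, List.reverse_nil, List.nil_append,
      List.reverse_replicate, List.cons_append]
    exact congrArg (first :: cell .bit1 :: ·) List.map_replicate.symm
  have hinit : (TM2.init .main (PartrecToTM2.trList [2 ^ Encodable.encode e]) :
      TM2.Cfg (fun _ : PartrecToTM2.K' => PartrecToTM2.Γ') PartrecToTM2.Λ'
        (Option PartrecToTM2.Γ')) = PartrecToTM2.init C [2 ^ Encodable.encode e] := by
    refine congrArg (TM2.Cfg.mk _ _) ?_
    funext k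
    cases k <;> rfl
  rw [eval_restrict_dom _ _ hS rfl, hword]
  have h1 := congrArg Part.Dom (TM1to0.tr_eval M1
    (TM2to1.trInit .main (PartrecToTM2.trList [2 ^ Encodable.encode e])))
  have h2 := TM2to1.tr_eval_dom PartrecToTM2.tr .main
    (PartrecToTM2.trList [2 ^ Encodable.encode e])
  have h3 := congrArg Part.Dom (PartrecToTM2.tr_eval C [2 ^ Encodable.encode e])
  have h4 := congrArg Part.Dom (hC ⟨[2 ^ Encodable.encode e], rfl⟩)
  rw [← hinit] at h3
  have h5 : ((C.eval [2 ^ Encodable.encode e]).Dom) = (e.eval 0).Dom := by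
    refine h4.trans ?_
    change (f (2 ^ Encodable.encode e)).Dom = _
    rw [hfe]
  exact (Iff.of_eq h1).trans (h2.trans ((Iff.of_eq h3).trans (Iff.of_eq h5)))

end Machine
end DL

/-! ### Computing the knowledge bases -/

namespace DL

namespace CheckGraph

variable {V : Type} {G G' : CheckGraph V} {code : V → ℕ} {live live' : V → Prop}
  {ci : Concept × Concept}

/-- The inclusions for a union of two sets of nodes can be listed separately. -/
theorem isAxiom_or : G.IsAxiom code (fun v => live v ∨ live' v) ci ↔
    G.IsAxiom code live ci ∨ G.IsAxiom code live' ci := by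
  constructor
  · rintro (_ | ⟨v, h | h, h1⟩ | ⟨v, w, h | h, h1, h2⟩ | ⟨v, w, h | h, h1, h2⟩ | ⟨v, h | h, h1⟩)
    exacts [.inl .start, .inl (.marked v h h1), .inr (.marked v h h1), .inl (.free v w h h1 h2),
      .inr (.free v w h h1 h2), .inl (.guarded v w h h1 h2), .inr (.guarded v w h h1 h2),
      .inl (.final v h h1), .inr (.final v h h1)]
  · rintro (h | h)
    · obtain _ | ⟨v, h, h1⟩ | ⟨v, w, h, h1, h2⟩ | ⟨v, w, h, h1, h2⟩ | ⟨v, h, h1⟩ := h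
      exacts [.start, .marked v (.inl h) h1, .free v w (.inl h) h1 h2,
        .guarded v w (.inl h) h1 h2, .final v (.inl h) h1]
    · obtain _ | ⟨v, h, h1⟩ | ⟨v, w, h, h1, h2⟩ | ⟨v, w, h, h1, h2⟩ | ⟨v, h, h1⟩ := h
      exacts [.start, .marked v (.inr h) h1, .free v w (.inr h) h1 h2,
        .guarded v w (.inr h) h1 h2, .final v (.inr h) h1]

/-- The inclusions only depend on the part of the graph at the described nodes. -/
theorem IsAxiom.congr (h : G.IsAxiom code live ci) (hs : G.start = G'.start)
    (hG : ∀ v, live v → (∀ w, G.edge v w ↔ G'.edge v w) ∧ (G.marked v ↔ G'.marked v) ∧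
      (G.checked v ↔ G'.checked v) ∧ (G.final v ↔ G'.final v)) : G'.IsAxiom code live ci := by
  obtain _ | ⟨v, h, h1⟩ | ⟨v, w, h, h1, h2⟩ | ⟨v, w, h, h1, h2⟩ | ⟨v, h, h1⟩ := h
  · rw [hs]
    exact .start
  · exact .marked v h ((hG v h).2.1.1 h1)
  · exact .free v w h (((hG v h).1 w).1 h1) (fun h3 => h2 ((hG v h).2.2.1.2 h3))
  · exact .guarded v w h (((hG v h).1 w).1 h1) ((hG v h).2.2.1.1 h2)
  · exact .final v h ((hG v h).2.2.2.1 h1)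

theorem finite_setOf_isAxiom (h : {v | live v}.Finite)
    (hE : ∀ v, live v → {w | G.edge v w}.Finite) : {ci | G.IsAxiom code live ci}.Finite := by
  have hfin : ∀ F : V → V → Concept × Concept,
      (⋃ v ∈ {v | live v}, F v '' {w | G.edge v w}).Finite :=
    fun F => h.biUnion fun v hv => (hE v hv).image _
  refine ((Set.finite_singleton (Concept.atom 2, Concept.ex 0 (nodeConcept (code G.start)))).union
    ((h.image fun v => (nodeConcept (code v), Concept.atom 0)).union
    ((h.image fun v => (nodeConcept (code v), Concept.atom 1)).union
    ((hfin fun v w => (nodeConcept (code v), .ex 0 (nodeConcept (code w)))).union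
    (hfin fun v w => (nodeConcept (code v),
      orConcept (.atom 1) (.ex 0 (nodeConcept (code w))))))))).subset ?_
  rintro _ (_ | ⟨v, h, h1⟩ | ⟨v, w, h, h1, h2⟩ | ⟨v, w, h, h1, h2⟩ | ⟨v, h, h1⟩)
  · exact .inl rfl
  · exact .inr (.inl ⟨v, h, rfl⟩)
  · exact .inr (.inr (.inr (.inl (Set.mem_biUnion h ⟨w, h1, rfl⟩))))
  · exact .inr (.inr (.inr (.inr (Set.mem_biUnion h ⟨w, h1, rfl⟩))))
  · exact .inr (.inr (.inl ⟨v, h, rfl⟩))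

end CheckGraph

namespace Concept

theorem primrec_atom : Primrec atom := by
  refine ((Primrec.of_equiv_symm (e := equivNat)).comp (Primrec.nat_add.comp
    (Primrec.nat_mul.comp (.const 4) .id) (.const 1))).of_eq fun n => ?_
  rw [Equiv.symm_apply_eq]
  rfl

theorem primrec_neg : Primrec neg := by
  refine ((Primrec.of_equiv_symm (e := equivNat)).comp (Primrec.nat_add.comp
    (Primrec.nat_mul.comp (.const 4) (Primrec.of_equiv (e := equivNat))) (.const 2))).of_eq
    fun n => ?_
  rw [Equiv.symm_apply_eq]
  rfl

theorem primrec_ex : Primrec₂ ex := by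
  refine ((Primrec.of_equiv_symm (e := equivNat)).comp (Primrec.nat_add.comp
    (Primrec.nat_mul.comp (.const 4) (Primrec₂.natPair.comp .fst
      ((Primrec.of_equiv (e := equivNat)).comp .snd))) (.const 4))).of_eq fun n => ?_
  rw [Equiv.symm_apply_eq]
  rfl

end Concept

theorem Assertion.primrec_conc : Primrec₂ Assertion.conc :=
  (Primrec.of_equiv_symm (e := Assertion.equivSum)).comp Primrec.sumInl

theorem KB.primrec_mk : Primrec₂ KB.mk :=
  Primrec.of_equiv_symm (e := KB.equivProd)

namespace CheckGraph

theorem primrec_nodeConcept : Primrec nodeConcept :=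
  Concept.primrec_neg.comp (Concept.primrec_atom.comp (Primrec.nat_add.comp .id (.const 3)))

theorem primrec_kbAbox : Primrec kbAbox := by
  have hc : ∀ i : ℕ, Primrec₂ fun (_ v : ℕ) => Assertion.conc (v + 3) i := fun i =>
    Assertion.primrec_conc.comp (Primrec.nat_add.comp .snd (.const 3)) (.const i)
  exact Primrec.list_append.comp (.const _) (Primrec.list_flatMap Primrec.list_range
    (Primrec.list_cons.comp (hc 0) (Primrec.list_cons.comp (hc 1)
      (Primrec.list_cons.comp (hc 2) (.const [])))))

end CheckGraph

namespace Automaton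

variable {D : Type}

/-- The number of a block, given a numbering of the triples of cells. The odd numbers belong to the
blocks of the input. -/
def Block.code (e : Option D × Option D × Option D → ℕ) : Block D → ℕ
  | .start => 0
  | .left => 2
  | .input i => 2 * i + 1
  | .right => 4
  | .main x y z => 2 * e (x, y, z) + 6

theorem Block.code_injective {e : Option D × Option D × Option D → ℕ}
    (he : Function.Injective e) : Function.Injective (Block.code e) := by
  intro β β' h
  rcases β with _ | _ | i | _ | ⟨x, y, z⟩ <;> rcases β' with _ | _ | i' | _ | ⟨x', y', z'⟩ <;>
    simp only [Block.code] at h <;> first | rfl | omega | skip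
  · obtain rfl : i = i' := by omega
    rfl
  · cases he (show e (x, y, z) = e (x', y', z') by omega)
    rfl

/-- The numbers of the nodes in the graph of a tableau. -/
def nodeCode (e : Option D × Option D × Option D → ℕ) (v : Block D × ℕ) : ℕ :=
  Nat.pair (v.1.code e) v.2

theorem nodeCode_injective {e : Option D × Option D × Option D → ℕ}
    (he : Function.Injective e) : Function.Injective (nodeCode e) := by
  rintro ⟨β, j⟩ ⟨β', j'⟩ h
  obtain ⟨h1, h2⟩ := Nat.pair_eq_pair.1 h
  exact Prod.ext (Block.code_injective he h1) h2

/-- The nodes of the blocks that do not depend on the input. -/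
def StaticNode (k : ℕ) (v : Block D × ℕ) : Prop := (∀ i, v.1 ≠ .input i) ∧ v.2 < 2 * k

/-- The nodes of the blocks of an input of length `len`. -/
def InputNode (k len : ℕ) (v : Block D × ℕ) : Prop := ∃ i < len, v.1 = .input i ∧ v.2 < 2 * k

theorem finite_staticNode [Finite D] (k : ℕ) : {v : Block D × ℕ | StaticNode k v}.Finite := by
  have : ({.start, .left, .right} ∪ Set.range fun x : Option D × Option D × Option D =>
      Block.main x.1 x.2.1 x.2.2).Finite := (Set.toFinite _).union (Set.finite_range _)
  refine (this.prod (Set.finite_Iio (2 * k))).subset ?_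
  rintro ⟨β, j⟩ ⟨h, hj⟩
  refine ⟨?_, hj⟩
  cases β with
  | input i => exact absurd rfl (h i)
  | main x y z => exact .inr ⟨(x, y, z), rfl⟩
  | _ => simp

theorem nodeCode_lt {e : Option D × Option D × Option D → ℕ} {k len E : ℕ} (hE : ∀ x, e x ≤ E)
    {v : Block D × ℕ} (h : StaticNode k v ∨ InputNode k len v) :
    nodeCode e v < (2 * len + (2 * E + 2 * k + 7)) * (2 * len + (2 * E + 2 * k + 7)) := by
  have h1 : v.1.code e ≤ 2 * len + 2 * E + 6 := by
    obtain ⟨β, j⟩ := v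
    cases β with
    | input i =>
      obtain h | ⟨i', hi', hi, -⟩ := h
      · exact absurd rfl (h.1 i)
      · obtain rfl : i = i' := by simpa using hi
        simp only [Block.code]
        omega
    | main x y z =>
      have := hE (x, y, z)
      simp only [Block.code]
      omega
    | _ => simp [Block.code]
  have h2 : v.2 < 2 * k := by
    obtain h | ⟨_, _, _, h⟩ := h
    exacts [h.2, h]
  refine (Nat.pair_lt_max_add_one_sq _ _).trans_le ?_
  rw [sq]
  exact Nat.mul_le_mul (by omega) (by omega)

/-- The concept inclusion for an edge between nodes with the given numbers. -/
def edgeAxiom (v w : ℕ) : Concept × Concept :=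
  (CheckGraph.nodeConcept v, .ex 0 (CheckGraph.nodeConcept w))

/-- The concept inclusion for a marked node with the given number. -/
def markAxiom (v : ℕ) : Concept × Concept := (CheckGraph.nodeConcept v, .atom 0)

/-- The concept inclusions for the `i`-th block of an input of length `len` whose colour is `c`. -/
def inputAxioms (k len i c : ℕ) : List (Concept × Concept) :=
  (List.range (2 * k - 1)).map
      (fun j => edgeAxiom (Nat.pair (2 * i + 1) j) (Nat.pair (2 * i + 1) (j + 1))) ++
    [edgeAxiom (Nat.pair (2 * i + 1) (2 * k - 1))
        (Nat.pair (if i + 1 = len then 4 else 2 * i + 3) 0),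
      markAxiom (Nat.pair (2 * i + 1) (2 * c))]

variable {A : Automaton D} {col : Option D → ℕ} {k len : ℕ} {w : ℕ → D}
  {e : Option D × Option D × Option D → ℕ}

theorem not_checked_input (i j : ℕ) :
    ¬ ((A.tableau col len w).toGraph k).checked (.input i, j) := by
  simp [BlockSystem.toGraph, tableau]

theorem not_final_input (i j : ℕ) :
    ¬ ((A.tableau col len w).toGraph k).final (.input i, j) := by
  simp [BlockSystem.toGraph, tableau]

/-- Input blocks have no bottom colour, so that their nodes are neither checked nor final. As their
top colour is not the wall, each of them has a single marked node. -/
theorem mem_inputAxioms_iff (hcol : Function.Injective col) (h0 : col none = 0)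
    (hk : ∀ x, col x < k) (ci : Concept × Concept) :
    ((A.tableau col len w).toGraph k).IsAxiom (nodeCode e) (InputNode k len) ci ↔
      ci = (.atom 2, .ex 0 (CheckGraph.nodeConcept (nodeCode e (.start, 0)))) ∨
      ∃ i < len, ci ∈ inputAxioms k len i (col (some (w i))) := by
  have hk0 : 0 < k := (Nat.zero_le _).trans_lt (hk none)
  constructor
  · rintro (_ | ⟨⟨_, j⟩, ⟨i, hi, rfl, hj⟩, h1⟩ | ⟨⟨_, j⟩, ⟨β, j'⟩, ⟨i, hi, rfl, hj⟩, h1, h2⟩ |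
      ⟨⟨_, j⟩, v, ⟨i, hi, rfl, hj⟩, h1, h2⟩ | ⟨⟨_, j⟩, ⟨i, hi, rfl, hj⟩, h1⟩)
    · exact .inl rfl
    · refine .inr ⟨i, hi, List.mem_append_right _ ?_⟩
      obtain ⟨c, hc, hj'⟩ := h1
      obtain rfl : col (some (w i)) = c := Option.some_injective _ hc
      obtain rfl | ⟨h, -⟩ := hj'
      · simp [markAxiom, nodeCode, Block.code]
      · exact absurd (hcol (h.trans h0.symm)) (by simp)
    · refine .inr ⟨i, hi, ?_⟩
      obtain ⟨hβ, hj', hlt⟩ | ⟨hj', h0', hn⟩ := h1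
      · obtain rfl : β = .input i := hβ
        obtain rfl : j' = j + 1 := hj'
        refine List.mem_append_left _ (List.mem_map.2 ⟨j, List.mem_range.2 ?_, rfl⟩)
        change j + 1 < 2 * k at hlt
        omega
      · refine List.mem_append_right _ (List.mem_cons.2 (.inl ?_))
        obtain rfl : j' = 0 := h0'
        obtain rfl : j = 2 * k - 1 := by
          change j + 1 = 2 * k at hj'
          omega
        change Next len (.input i) β at hn
        cases hn with
        | input_input _ h => rw [if_neg h.ne]; rfl
        | input_right _ h => rw [if_pos h]; rfl
    · exact absurd h2 (not_checked_input i j)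
    · exact absurd h1 (not_final_input i j)
  · rintro (rfl | ⟨i, hi, h⟩)
    · exact .start
    · have edge : ∀ j < 2 * k, ∀ v, ((A.tableau col len w).toGraph k).edge (.input i, j) v →
          ((A.tableau col len w).toGraph k).IsAxiom (nodeCode e) (InputNode k len)
            (edgeAxiom (Nat.pair (2 * i + 1) j) (nodeCode e v)) := fun j hj v hv =>
        .free (.input i, j) v ⟨i, hi, rfl, hj⟩ hv (not_checked_input i j)
      simp only [inputAxioms, List.mem_append, List.mem_map, List.mem_range, List.mem_cons,
        List.not_mem_nil, or_false] at h
      obtain ⟨j, hj, rfl⟩ | rfl | rfl := h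
      · exact edge j (by omega) (.input i, j + 1) (.inl ⟨rfl, rfl, by simp only; omega⟩)
      · split_ifs with hl
        · exact edge _ (by omega) (.right, 0)
            (.inr ⟨by simp only; omega, rfl, .input_right i hl⟩)
        · exact edge _ (by omega) (.input (i + 1), 0)
            (.inr ⟨by simp only; omega, rfl, .input_input i (by omega)⟩)
      · have := hk (some (w i))
        exact CheckGraph.IsAxiom.marked (code := nodeCode e)
          (.input i, 2 * col (some (w i))) ⟨i, hi, rfl, by simp only; omega⟩ ⟨_, rfl, .inl rfl⟩

/-- The inclusions for the other blocks depend neither on the input word nor on its length. -/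
theorem isAxiom_staticNode_congr {len' : ℕ} {w' : ℕ → D} {ci : Concept × Concept}
    (h : ((A.tableau col len w).toGraph k).IsAxiom (nodeCode e) (StaticNode k) ci) :
    ((A.tableau col len' w').toGraph k).IsAxiom (nodeCode e) (StaticNode k) ci := by
  refine h.congr rfl ?_
  rintro ⟨β, j⟩ ⟨hβ, -⟩
  have hn : ∀ {l l' : ℕ} {β' : Block D}, Next l β β' → Next l' β β' := by
    intro l l' β' h
    cases h with
    | input_input i _ => exact absurd rfl (hβ i)
    | input_right i _ => exact absurd rfl (hβ i)
    | _ => constructor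
  refine ⟨fun v => or_congr Iff.rfl (and_congr Iff.rfl (and_congr Iff.rfl ⟨hn, hn⟩)), ?_⟩
  cases β with
  | input i => exact absurd rfl (hβ i)
  | _ => exact ⟨Iff.rfl, Iff.rfl, Iff.rfl⟩

theorem finite_setOf_isAxiom_staticNode [Finite D] :
    {ci | ((A.tableau col len w).toGraph k).IsAxiom (nodeCode e) (StaticNode k) ci}.Finite := by
  refine CheckGraph.finite_setOf_isAxiom (finite_staticNode k) fun v hv => ?_
  refine ((finite_staticNode k).union
    ((Set.finite_singleton ((.input 0, 0) : Block D × ℕ)))).subset ?_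
  obtain ⟨β, j⟩ := v
  obtain ⟨hβ, hj⟩ := hv
  rintro ⟨β', j'⟩ (⟨hβ', hj', hlt⟩ | ⟨hj', h0', hn⟩)
  · obtain rfl : β' = β := hβ'
    obtain rfl : j' = j + 1 := hj'
    exact .inl ⟨hβ, hlt⟩
  · obtain rfl : j' = 0 := h0'
    have hk : 0 < 2 * k := (Nat.zero_le _).trans_lt hj
    change Next len β β' at hn
    cases hn with
    | left_input => exact .inr rfl
    | input_input i _ => exact absurd rfl (hβ i)
    | input_right i _ => exact absurd rfl (hβ i)
    | _ => exact .inl ⟨fun i => nofun, hk⟩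

theorem live_of_edge {v v' : Block D × ℕ} (hlen : 0 < len)
    (hv : StaticNode k v ∨ InputNode k len v)
    (h : ((A.tableau col len w).toGraph k).edge v v') :
    StaticNode k v' ∨ InputNode k len v' := by
  obtain ⟨β, j⟩ := v
  obtain ⟨β', j'⟩ := v'
  obtain ⟨hβ, hj', hlt⟩ | ⟨hj', h0, hn⟩ := h
  · obtain rfl : β' = β := hβ
    obtain rfl : j' = j + 1 := hj'
    exact hv.imp (fun h => ⟨h.1, hlt⟩) fun ⟨i, hi, h, _⟩ => ⟨i, hi, h, hlt⟩
  · obtain rfl : j' = 0 := h0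
    have hk : 0 < 2 * k := by
      obtain h | ⟨_, _, _, h⟩ := hv
      exacts [(Nat.zero_le _).trans_lt h.2, (Nat.zero_le _).trans_lt h]
    change Next len β β' at hn
    cases hn with
    | left_input => exact .inr ⟨0, hlen, rfl, hk⟩
    | input_input i h => exact .inr ⟨i + 1, h, rfl, hk⟩
    | _ => exact .inl ⟨fun i => nofun, hk⟩

theorem primrec_edgeAxiom : Primrec₂ edgeAxiom :=
  Primrec.pair (CheckGraph.primrec_nodeConcept.comp .fst)
    (Concept.primrec_ex.comp (.const 0) (CheckGraph.primrec_nodeConcept.comp .snd))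

theorem primrec_inputAxioms {α : Type} [Primcodable α] {l i c : α → ℕ} (hl : Primrec l)
    (hi : Primrec i) (hc : Primrec c) : Primrec fun x => inputAxioms k (l x) (i x) (c x) := by
  have hi' : ∀ m : ℕ, Primrec fun x => 2 * i x + m := fun m =>
    Primrec.nat_add.comp (Primrec.nat_mul.comp (.const 2) hi) (.const m)
  refine Primrec.list_append.comp (Primrec.list_map (.const _) (primrec_edgeAxiom.comp
    (Primrec₂.natPair.comp ((hi' 1).comp .fst) .snd)
    (Primrec₂.natPair.comp ((hi' 1).comp .fst) (Primrec.succ.comp .snd))))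
    (Primrec.list_cons.comp (primrec_edgeAxiom.comp (Primrec₂.natPair.comp (hi' 1) (.const _))
      (Primrec₂.natPair.comp (Primrec.ite (Primrec.eq.comp (Primrec.succ.comp hi) hl) (.const 4)
        (hi' 3)) (.const 0))) (Primrec.list_cons.comp (.pair
          (CheckGraph.primrec_nodeConcept.comp (Primrec₂.natPair.comp (hi' 1)
            (Primrec.nat_mul.comp (.const 2) hc))) (.const _)) (.const [])))

end Automaton
end DL

/-! ### Undecidability -/

namespace DL

open Turing

/-- Halting on the input `0` reduces computably to the failure of entailment, from a knowledge base
with empty TBox to its extension by a TBox. -/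
theorem exists_reduction : ∃ (T : Nat.Partrec.Code → TBox) (A : Nat.Partrec.Code → List Assertion),
    Computable T ∧ Computable A ∧ (∀ c, (KB.mk (T c) (A c)).Consistent) ∧
    ∀ (c : Nat.Partrec.Code) (Q : QueryClass) (S : Signature),
      (∀ d m, (CheckGraph.pathQuery d m).Over S) →
      ((KB.mk [] (A c)).QEntails Q S (KB.mk (T c) (A c)) ↔ ¬ (c.eval 0).Dom) := by
  classical
  obtain ⟨Γ, Λ, _, _, _, _, M, a, b, z, hM⟩ := Machine.exists_universal
  let D := Γ × Option Λ
  let col : Option D → ℕ := fun x => x.elim 0 fun d => (Finite.equivFin D d : ℕ) + 1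
  have h0 : col none = 0 := rfl
  have hcol : Function.Injective col := by
    rintro (_ | d) (_ | d') h
    · rfl
    · simp [col] at h
    · simp [col] at h
    · exact congrArg some ((Finite.equivFin D).injective (Fin.ext (Nat.succ_injective h)))
  let k := Nat.card D + 2
  have hk : ∀ x, col x < k := by
    rintro (_ | d)
    · simp [col, k]
    · have := (Finite.equivFin D d).2
      simp only [col, k, Option.elim_some]
      omega
  let e : Option D × Option D × Option D → ℕ := fun x => Finite.equivFin _ x
  have he : Function.Injective e := fun x y h => (Finite.equivFin _).injective (Fin.ext h)
  have hE : ∀ x, e x ≤ Nat.card (Option D × Option D × Option D) := fun x =>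
    (Finite.equivFin _ x).2.le
  let E := 2 * Nat.card (Option D × Option D × Option D) + 2 * k + 7
  -- The input word for the code with number `n`, and the colours of its letters. The colour of a
  -- letter does not depend on `n`.
  let l : ℕ → List Γ := fun n => a :: b :: List.replicate n z
  have hl : ∀ n, (l n).length = n + 2 := fun n => by simp [l]
  let G : ℕ → CheckGraph (Automaton.Block D × ℕ) := fun n =>
    ((Machine.automaton M).tableau col (n + 2) (Machine.word (l n))).toGraph k
  let c : ℕ → ℕ := fun i =>
    if i = 0 then col (some (a, some default)) else
      if i = 1 then col (some (b, none)) else col (some (z, none))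
  have hc : ∀ n, ∀ i < n + 2, col (some (Machine.word (l n) i)) = c i := by
    rintro n (_ | _ | i) hi
    · rfl
    · rfl
    · have : (List.replicate n z).getI i = z := by
        rw [List.getI_eq_getElem _ (by simpa using hi), List.getElem_replicate]
      simp only [Machine.word, c, l, List.getI_cons_succ, this]
      simp
  have hF : {ci | (G 0).IsAxiom (Automaton.nodeCode e) (Automaton.StaticNode k) ci}.Finite :=
    Automaton.finite_setOf_isAxiom_staticNode
  -- The static part of the TBox is a constant list, taken from the graph for `n = 0`.
  let T : ℕ → TBox := fun n => hF.toFinset.toList ++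
    (List.range (n + 2)).flatMap fun i => Automaton.inputAxioms k (n + 2) i (c i)
  let B : ℕ → ℕ := fun n => (2 * (n + 2) + E) * (2 * (n + 2) + E)
  let live : ℕ → Automaton.Block D × ℕ → Prop := fun n v =>
    Automaton.StaticNode k v ∨ Automaton.InputNode k (n + 2) v
  have hT : ∀ n ci, ci ∈ T n ↔ (G n).IsAxiom (Automaton.nodeCode e) (live n) ci := by
    intro n ci
    have hstatic : ci ∈ hF.toFinset.toList ↔
        (G n).IsAxiom (Automaton.nodeCode e) (Automaton.StaticNode k) ci := by
      rw [Finset.mem_toList, Set.Finite.mem_toFinset]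
      exact ⟨Automaton.isAxiom_staticNode_congr, Automaton.isAxiom_staticNode_congr⟩
    rw [CheckGraph.isAxiom_or, Automaton.mem_inputAxioms_iff hcol h0 hk, List.mem_append, hstatic,
      List.mem_flatMap]
    have hinput : (∃ i ∈ List.range (n + 2), ci ∈ Automaton.inputAxioms k (n + 2) i (c i)) ↔
        ∃ i < n + 2, ci ∈ Automaton.inputAxioms k (n + 2) i
          (col (some (Machine.word (l n) i))) := by
      refine exists_congr fun i => ?_
      rw [List.mem_range]
      exact and_congr_right fun hi => by rw [hc n i hi]
    rw [hinput]
    refine ⟨Or.imp_right .inr, ?_⟩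
    rintro (h | rfl | h)
    exacts [.inl h, .inl .start, .inr h]
  have hS : ∀ n, ((Machine.automaton M).tableau col (n + 2) (Machine.word (l n))).IsTableau k :=
    fun n => Automaton.isTableau hcol h0 hk
  have hsolv : ∀ n, (G n).Solvable ↔
      (StateTransition.eval (TM0.step M) (TM0.init (l n))).Dom := fun n => by
    rw [← Machine.tableau_solvable_iff (by simp [l]) hcol h0, hl]
    exact ⟨BlockSystem.solvable_of_toGraph _ (by simp [k]) (hS n),
      BlockSystem.toGraph_solvable _ (hS n)⟩
  have hprimT : Primrec T := by
    have hadd : Primrec fun n : ℕ => n + 2 := Primrec.nat_add.comp .id (.const 2)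
    have hprimc : Primrec c := Primrec.ite (Primrec.eq.comp .id (.const 0)) (.const _)
      (Primrec.ite (Primrec.eq.comp .id (.const 1)) (.const _) (.const _))
    exact Primrec.list_append.comp (.const _) (Primrec.list_flatMap
      (Primrec.list_range.comp hadd)
      (Automaton.primrec_inputAxioms (hadd.comp .fst) .snd (hprimc.comp .snd)))
  have hprimB : Primrec B := by
    have h : Primrec fun n : ℕ => 2 * (n + 2) + E := Primrec.nat_add.comp (Primrec.nat_mul.comp
      (.const 2) (Primrec.nat_add.comp .id (.const 2))) (.const E)
    exact Primrec.nat_mul.comp h h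
  refine ⟨fun p => T (Encodable.encode p), fun p => CheckGraph.kbAbox (B (Encodable.encode p)),
    (hprimT.comp Primrec.encode).to_comp,
    (CheckGraph.primrec_kbAbox.comp (hprimB.comp Primrec.encode)).to_comp,
    fun p => (G _).consistent_tbox (hT _) _, fun p Q S hS' => ?_⟩
  rw [(G _).qEntails_iff (Automaton.nodeCode_injective he)
    (fun v hv => Automaton.nodeCode_lt hE hv) (hT _) ?_ (.inl ⟨fun i => nofun, by simp [k, G,
      BlockSystem.toGraph]⟩) (fun v v' hv h => Automaton.live_of_edge (by omega) hv h) Q S hS',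
    hsolv]
  · exact not_congr (hM p)
  · rintro v ⟨-, c, hc, hv⟩
    exact ⟨c, hc, .inl hv⟩

/-- A problem to which the complement of the halting problem reduces is undecidable, even if it is
only to be solved on valid inputs, provided that the reduction yields valid inputs. -/
theorem not_decidableProblem {α : Type} [Primcodable α] {Valid Yes : α → Prop}
    (g : Nat.Partrec.Code → α) (hg : Computable g) (hv : ∀ c, Valid (g c))
    (hy : ∀ c, Yes (g c) ↔ ¬ (c.eval 0).Dom) : ¬ DecidableProblem Valid Yes := by
  classical
  rintro ⟨f, hf, h⟩
  refine ComputablePred.halting_problem 0 ?_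
  have hcomp : Computable fun c : Nat.Partrec.Code => decide ¬ (c.eval 0).Dom := by
    refine Partrec.of_eq_tot (hf.comp hg) fun c => ?_
    by_cases hc : (c.eval 0).Dom
    · simpa [hc] using (h _ (hv c)).2 fun hyes => (hy c).1 hyes hc
    · simpa [hc] using (h _ (hv c)).1 ((hy c).2 hc)
  have hpred : ComputablePred fun c : Nat.Partrec.Code => ¬ (c.eval 0).Dom := ⟨_, hcomp⟩
  simpa only [not_not] using hpred.not

end DL

theorem mainTheorem2
    (L : DL.TBox → Prop) (hL : L = DL.TBox.IsHornALC ∨ L = DL.TBox.IsEL)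
    (Q : DL.QueryClass) :
    -- entailment, the signature being part of the input
    (¬ DL.DecidableProblem
      (fun x : (List ℕ × List ℕ) × DL.KB × DL.KB =>
        L x.2.1.tbox ∧ x.2.1.Consistent ∧ x.2.2.Consistent)
      (fun x => x.2.1.QEntails Q (DL.Signature.ofLists x.1) x.2.2)) ∧
    -- inseparability, the signature being part of the input
    (¬ DL.DecidableProblem
      (fun x : (List ℕ × List ℕ) × DL.KB × DL.KB =>
        L x.2.1.tbox ∧ x.2.1.Consistent ∧ x.2.2.Consistent)
      (fun x => x.2.1.QInseparable Q (DL.Signature.ofLists x.1) x.2.2)) ∧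
    -- entailment for the full signature
    (¬ DL.DecidableProblem
      (fun x : DL.KB × DL.KB => L x.1.tbox ∧ x.1.Consistent ∧ x.2.Consistent)
      (fun x => x.1.QEntails Q DL.Signature.full x.2)) ∧
    -- inseparability for the full signature
    (¬ DL.DecidableProblem
      (fun x : DL.KB × DL.KB => L x.1.tbox ∧ x.1.Consistent ∧ x.2.Consistent)
      (fun x => x.1.QInseparable Q DL.Signature.full x.2)) := by
  obtain ⟨T, A, hT, hA, hcons, hred⟩ := DL.exists_reduction
  -- The empty TBox belongs to both languages.
  have hL0 : L [] := by
    obtain rfl | rfl := hL <;> exact fun ci h => absurd h List.not_mem_nil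
  have hpair : Computable fun c => (DL.KB.mk [] (A c), DL.KB.mk (T c) (A c)) :=
    (DL.KB.primrec_mk.to_comp.comp (.const []) hA).pair (DL.KB.primrec_mk.to_comp.comp hT hA)
  have hvalid : ∀ c, L [] ∧ (DL.KB.mk [] (A c)).Consistent ∧ (DL.KB.mk (T c) (A c)).Consistent :=
    fun c => ⟨hL0, (hcons c).imp fun _ h => DL.CheckGraph.isModel_abox_of_isModel h, hcons c⟩
  -- The second knowledge base contains the first one, so it entails the first one in any case.
  have hinsep : ∀ S c, (DL.KB.mk [] (A c)).QInseparable Q S (DL.KB.mk (T c) (A c)) ↔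
      (DL.KB.mk [] (A c)).QEntails Q S (DL.KB.mk (T c) (A c)) := fun S c =>
    and_iff_left (DL.CheckGraph.qEntails_abox Q S _ _)
  have hlists : ∀ d m, (DL.CheckGraph.pathQuery d m).Over (DL.Signature.ofLists ([0, 1], [0])) :=
    DL.CheckGraph.pathQuery_over
  have hfull : ∀ d m, (DL.CheckGraph.pathQuery d m).Over DL.Signature.full := fun d m α _ => by
    cases α <;> trivial
  refine ⟨DL.not_decidableProblem _ ((Computable.const ([0, 1], [0])).pair hpair) hvalid
      fun c => hred c Q _ hlists,
    DL.not_decidableProblem _ ((Computable.const ([0, 1], [0])).pair hpair) hvalid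
      fun c => (hinsep _ c).trans (hred c Q _ hlists),
    DL.not_decidableProblem _ hpair hvalid fun c => hred c Q _ hfull,
    DL.not_decidableProblem _ hpair hvalid fun c => (hinsep _ c).trans (hred c Q _ hfull)⟩
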